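/- **Setting.** Consider a Markov decision process with state space $\mathcal S$, action space $\mathcal A$ (measurable spaces), horizon $H\ge 1$, initial distribution $\rho$, transition kernel $P(s,a)$ and stochastic reward $R(s,a)$ supported in $[0,1]$. For a (randomized, Markov) policy $\pi=(\pi_0,\dots,\pi_{H-1})$ let $V^\pi_h(s)=\mathbb E[\sum_{\tau=h}^{H-1}r_\tau\mid\pi,s_h=s]$, $Q^\pi_h(s,a)=\mathbb E[\sum_{\tau=h}^{H-1}r_\tau\mid\pi,s_h=s,a_h=a]$, $V^\pi=\mathbb E_{s\sim\rho}V^\pi_0(s)$, let $d^\pi_h$ be the law of $(s_h,a_h)$ under $\pi$, and let $\mathcal Tf(s,a)=\mathbb E[R(s,a)]+\mathbb E_{s'\sim P(s,a)}\max_{a'}f(s',a')$. Let $\mathcal C=\mathcal C_0\times\dots\times\mathcal C_{H-1}\subseteq\mathcal F=\mathcal F_0\times\dots\times\mathcal F_{H-1}$ be finite classes, where every $f\in\mathcal C_h$ is a measurable function $\mathcal S\times\mathcal A\to[0,V_{\max}]$; put $f_H=0$ and $|\mathcal F|=\prod_h|\mathcal F_h|$. Maxima over actions of functions of $\mathcal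 C_h$ are attained, and a measurable rule $f\mapsto\arg\max_a f(\cdot,a)$ is fixed for these functions and for $f=0$; $\pi^f$ is the resulting greedy policy, $\pi^f_h(s)=\arg\max_af_h(s,a)$. Let $\pi^{\mathrm{ref}}$ be a reference policy, $Q^{\mathrm{ref}}=Q^{\pi^{\mathrm{ref}}}$, $V^{\mathrm{ref}}=\mathbb E_{s\sim\rho}\max_aQ^{\mathrm{ref}}_0(s,a)$. Assume $Q^{\mathrm{ref}}_h\in\mathcal C_h$ and that $\mathcal C$ is closed under calibration: $\max\{f,Q^{\mathrm{ref}}_h\}\in\mathcal C_h$ for all $f\in\mathcal C_h$ and all $h$. Let $\mathcal C_{\mathrm{ref}}=\{f\in\mathcal C: f_h\ge Q^{\mathrm{ref}}_h\ \forall h\}$. *Bilinear rank.* A set $\mathcal G\subseteq\mathcal C$ has bilinear rank $d$ (with bounds $B_X,B_W$) if for every $h\in\{0,\dots,H-1\}$ there are $X_h,W_h:\mathcal G\to\mathbb R^d$ with $\|X_h(f)\|_2\le B_X$, $\|W_h(f)\|_2\le B_W$ and $|\mathbb E_{(s,a)\sim d_h^{\pi^f}}[g_h-\mathcal Tg_{h+1}]|=|\langle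 X_h(f),W_h(g)\rangle|$ for all $f,g\in\mathcal G$. *Pessimistic class.* $\mathcal C$ is pessimistic with respect to a policy $\pi^e$ if for all $h$: $Q^{\pi^e}_h\in\mathcal C_h$; $\mathcal Tf_{h+1}\in\mathcal C_h$ for all $f_{h+1}\in\mathcal C_{h+1}$; and $f_h\le Q_h^{\pi^e}$ pointwise for all $f_h\in\mathcal C_h$. *Transfer coefficient.* For offline distributions $\nu_0,\dots,\nu_{H-1}$ on $\mathcal S\times\mathcal A$, $$C^{\mathrm{ref}}_\pi=\max\Big\{1,\ \max_{f\in\mathcal C_{\mathrm{ref}}}\frac{\sum_{h}\mathbb E_{d_h^\pi}[\mathcal Tf_{h+1}-f_h]}{\sqrt{\sum_{h}\mathbb E_{\nu_h}(\mathcal Tf_{h+1}-f_h)^2}}\Big\}\in[1,\infty],$$ where a ratio with zero denominator is $+\infty$ if its numerator is positive and is omitted otherwise. *Algorithm (theoretical Cal-QL, $m_{\mathrm{off}}=K$, $m_{\mathrm{on}}=1$).* For each $h$ there are $K$ i.i.d. offline tuples $(s,a,r,s')$ with $(s,a)\sim\nu_h$, $r\sim R(s,a)$, $s'\sim P(s,a)$.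 Start with $f^1=0$. In round $k=1,\dots,K$ play $\pi^k=\pi^{f^k}$ and for each $h$ collect one tuple $(s,a,r,s')$ which, conditionally on all earlier information, has $(s,a)\sim d_h^{\pi^k}$, $r\sim R(s,a)$, $s'\sim P(s,a)$. Then put $f^{k+1}_H=0$ and for $h=H-1,\dots,0$ let $\hat f_h^{k+1}\in\mathcal C_h$ be a minimizer over $f\in\mathcal C_h$ of the sum of $(f(s,a)-r-\max_{a'}f^{k+1}_{h+1}(s',a'))^2$ over all offline tuples of stage $h$ and all online tuples of stage $h$ collected in rounds $1,\dots,k$, and set $f_h^{k+1}=\max\{\hat f_h^{k+1},Q^{\mathrm{ref}}_h\}$. **Theorem.** There is a universal constant $c>0$ such that the following holds in the setting above. Let $\delta\in(0,1)$, $K\ge1$, and suppose that $\mathcal C$ has bilinear rank $d\ge1$ and $\mathcal C_{\mathrm{ref}}$ has bilinear rank $d_{\mathrm{ref}}\ge1$, with bounds $B_X,B_W$. Then with probability at least $1-\delta$, for every comparator policy $\pi^e$ with respect to which $\mathcal C$ is pessimistic, $$\sum_{k=1}^K\big(V^{\pi^e}-V^{\pi^k}\big)\le\min\Big\{C^{\mathrm{ref}}_{\pi^e}\,\beta\,H\sqrt{dK\,L},\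 \ K\big(V^{\pi^e}-V^{\mathrm{ref}}\big)+\beta\,H\sqrt{d_{\mathrm{ref}}K\,L}\Big\},$$ where $\beta=c\,(1+V_{\max}+B_XB_W)$ and $L=\log(2HK|\mathcal F|/\delta)\,\log(1+K)$. That is, up to logarithmic factors and factors depending only on $V_{\max},B_X,B_W$, the cumulative suboptimality is $\widetilde O\big(\min\{C^{\mathrm{ref}}_{\pi^e}H\sqrt{dK\log(|\mathcal F|/\delta)},\ K(V^{\pi^e}-V^{\mathrm{ref}})+H\sqrt{d_{\mathrm{ref}}K\log(|\mathcal F|/\delta)}\}\big)$. -/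

import Mathlib

open MeasureTheory ProbabilityTheory
open scoped ENNReal

namespace CalQL

noncomputable section

/-- A (time-homogeneous) Markov decision process: transition kernel, stochastic reward with values
in `[0,1]`, initial state distribution. The horizon is a separate parameter `H`. -/
structure MDP (S A : Type*) [MeasurableSpace S] [MeasurableSpace A] where
  /-- transition kernel `P(s,a)` -/
  P : Kernel (S × A) S
  /-- stochastic reward `R(s,a)` -/
  R : Kernel (S × A) ℝ
  /-- initial state distribution -/
  ρ : Measure S
  markovP : IsMarkovKernel P
  markovR : IsMarkovKernel R
  probρ : IsProbabilityMeasure ρ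
  reward_mem : ∀ z, ∀ᵐ r ∂(R z), r ∈ Set.Icc (0 : ℝ) 1

/-- A randomized Markov policy `π_h : S → Δ(A)`; only the steps `h < H` ever matter. -/
structure Policy (S A : Type*) [MeasurableSpace S] [MeasurableSpace A] where
  act : ℕ → Kernel S A
  markov : ∀ h, IsMarkovKernel (act h)

attribute [instance] MDP.markovP MDP.markovR MDP.probρ Policy.markov

/-- An observed tuple `((s,a),(r,s'))`. -/
abbrev Tuple (S A : Type*) := (S × A) × (ℝ × S)

/-- A candidate Q-function `f = (f_0, …, f_{H-1})`. -/
abbrev QTuple (S A : Type*) (H : ℕ) := Fin H → S × A → ℝ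

/-- The component `f_h`, with the convention `f_H = 0`. -/
def QTuple.at {S A : Type*} {H : ℕ} (f : QTuple S A H) (h : ℕ) : S × A → ℝ :=
  if hh : h < H then f ⟨h, hh⟩ else 0

/-- A stage-wise finite function class `C = C_0 × ⋯ × C_{H-1}`. -/
abbrev FunClass (S A : Type*) (H : ℕ) := Fin H → Finset (S × A → ℝ)

/-- `|C| = ∏_h |C_h|`. -/
def FunClass.size {S A : Type*} {H : ℕ} (C : FunClass S A H) : ℕ := ∏ h, (C h).card

section

variable {S A : Type*} [MeasurableSpace S] [MeasurableSpace A]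

/-- Mean reward. -/
def MDP.meanReward (M : MDP S A) (z : S × A) : ℝ := ∫ r, r ∂(M.R z)

/-- Transition of the state-action pair from step `h` to step `h + 1` under `π`. -/
def MDP.step (M : MDP S A) (π : Policy S A) (h : ℕ) : Kernel (S × A) (S × A) :=
  M.P ⊗ₖ Kernel.prodMkLeft (S × A) (π.act (h + 1))

/-- `M.occFrom π n h (s,a)` is the law of `(s_{h+n}, a_{h+n})` under `π` given
`s_h = s, a_h = a`. -/
def MDP.occFrom (M : MDP S A) (π : Policy S A) : ℕ → ℕ → Kernel (S × A) (S × A)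
  | 0, _ => Kernel.id
  | n + 1, h => M.occFrom π n (h + 1) ∘ₖ M.step π h

/-- `d_h^π`: the law of `(s_h, a_h)` under `π` started from `s_0 ∼ ρ`. -/
def MDP.occ (M : MDP S A) (π : Policy S A) : ℕ → Measure (S × A)
  | 0 => M.ρ ⊗ₘ π.act 0
  | h + 1 => (M.occ π h).bind (M.step π h)

/-- `Q_h^π(s,a) = E[∑_{τ=h}^{H-1} r_τ | π, s_h = s, a_h = a]`. -/
def MDP.Q (M : MDP S A) (H : ℕ) (π : Policy S A) (h : ℕ) (z : S × A) : ℝ :=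
  ∑ n ∈ Finset.range (H - h), ∫ w, M.meanReward w ∂(M.occFrom π n h z)

/-- `V_h^π(s) = E[∑_{τ=h}^{H-1} r_τ | π, s_h = s]`. -/
def MDP.V (M : MDP S A) (H : ℕ) (π : Policy S A) (h : ℕ) (s : S) : ℝ :=
  ∫ a, M.Q H π h (s, a) ∂(π.act h s)

/-- `V^π = E_{s ∼ ρ} V_0^π(s)`. -/
def MDP.value (M : MDP S A) (H : ℕ) (π : Policy S A) : ℝ := ∫ s, M.V H π 0 s ∂M.ρ

/-- `V^ref = E_{s ∼ ρ} max_a Q_0^ref(s,a)`. -/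
def MDP.refValue (M : MDP S A) (H : ℕ) (πref : Policy S A) : ℝ :=
  ∫ s, (⨆ a, M.Q H πref 0 (s, a)) ∂M.ρ

/-- Bellman optimality operator
`T f (s,a) = E[R(s,a)] + E_{s' ∼ P(s,a)} max_{a'} f(s',a')`. -/
def MDP.bellman (M : MDP S A) (f : S × A → ℝ) (z : S × A) : ℝ :=
  M.meanReward z + ∫ s', (⨆ a', f (s', a')) ∂(M.P z)

/-- Law of a tuple `(s,a,r,s')` with `(s,a) ∼ μ`, `r ∼ R(s,a)`, `s' ∼ P(s,a)`. -/
def MDP.tupleLaw (M : MDP S A) (μ : Measure (S × A)) : Measure (Tuple S A) :=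
  μ ⊗ₘ (M.R ×ₖ M.P)

/-- A fixed measurable choice of a maximizing action, `s ↦ argmax_a f(s,a)`, for each function `f`
of the class `C` and for `f = 0`. (The values of `sel` at other functions are irrelevant.) -/
structure ArgmaxRule {H : ℕ} (C : FunClass S A H) where
  sel : (S × A → ℝ) → S → A
  measurable_sel : ∀ f, Measurable (sel f)
  isMax : ∀ h, ∀ f ∈ C h, ∀ s a, f (s, a) ≤ f (s, sel f s)

/-- Greedy policy `π^f`, `π^f_h(s) = argmax_a f_h(s,a)`. -/
def ArgmaxRule.greedy {H : ℕ} {C : FunClass S A H} (g : ArgmaxRule C) (f : QTuple S A H) :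
    Policy S A where
  act h := Kernel.deterministic (g.sel (f.at h)) (g.measurable_sel _)
  markov _ := inferInstance

/-- Pessimistic realizability and completeness of `C` with respect to `πe`. -/
structure IsPessimistic {H : ℕ} (M : MDP S A) (C : FunClass S A H) (πe : Policy S A) : Prop where
  realizable : ∀ h : Fin H, M.Q H πe h ∈ C h
  complete : ∀ (h : ℕ) (hh : h + 1 < H), ∀ f ∈ C ⟨h + 1, hh⟩,
    M.bellman f ∈ C ⟨h, Nat.lt_of_succ_lt hh⟩
  pessimistic : ∀ h : Fin H, ∀ f ∈ C h, ∀ z, f z ≤ M.Q H πe h z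

/-- The calibrated class `C_ref = {f ∈ C : f ≥ Q^ref}`. -/
def calibrated {H : ℕ} (M : MDP S A) (C : FunClass S A H) (πref : Policy S A) :
    Set (QTuple S A H) :=
  {f | ∀ h : Fin H, f h ∈ C h ∧ ∀ z, M.Q H πref h z ≤ f h z}

/-- The MDP with the set `G` of Q-functions is a bilinear model of rank `d`, with feature bounds
`BX` and `BW`. -/
def IsBilinear {H : ℕ} {C : FunClass S A H} (M : MDP S A) (g : ArgmaxRule C)
    (G : Set (QTuple S A H)) (d : ℕ) (BX BW : ℝ) : Prop :=
  ∀ h : Fin H, ∃ X W : QTuple S A H → EuclideanSpace ℝ (Fin d),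
    (∀ f ∈ G, ‖X f‖ ≤ BX) ∧ (∀ f ∈ G, ‖W f‖ ≤ BW) ∧
    ∀ f ∈ G, ∀ f' ∈ G,
      |∫ z, (f' h z - M.bellman (f'.at (h + 1)) z) ∂(M.occ (g.greedy f) h)|
        = |inner ℝ (X f) (W f')|

/-- Calibrated Bellman error transfer coefficient of `π`, at least `1` by convention. Division in
`ℝ≥0∞`: `0 / 0 = 0` and `x / 0 = ∞` for `x > 0`. -/
def transferCoeff {H : ℕ} (M : MDP S A) (C : FunClass S A H) (πref : Policy S A)
    (ν : Fin H → Measure (S × A)) (π : Policy S A) : ℝ≥0∞ :=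
  max 1 (⨆ f ∈ calibrated M C πref,
    ENNReal.ofReal (∑ h : Fin H, ∫ z, (M.bellman (f.at (h + 1)) z - f h z) ∂(M.occ π h)) /
    ENNReal.ofReal (Real.sqrt
      (∑ h : Fin H, ∫ z, (M.bellman (f.at (h + 1)) z - f h z) ^ 2 ∂(ν h))))

/-- Squared temporal-difference error of `f` on one tuple, with next-step function `next`. -/
def tdSq (f next : S × A → ℝ) (x : Tuple S A) : ℝ :=
  (f x.1 - x.2.1 - ⨆ a', next (x.2.2, a')) ^ 2

/-- Least-squares objective of stage `h` on the aggregated data: all offline tuples of stage `h`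
and the online tuples of stage `h` collected in the rounds `0, …, k`. -/
def lsLoss {H K : ℕ} (off : Fin H → Fin K → Tuple S A) (onl : ℕ → Fin H → Tuple S A)
    (k : ℕ) (h : Fin H) (next f : S × A → ℝ) : ℝ :=
  ∑ i, tdSq f next (off h i) + ∑ τ ∈ Finset.range (k + 1), tdSq f next (onl τ h)

/-- The iterates of the algorithm, rounds numbered `0, …, K-1`: the first one is `0`, and the
next ones are the regression solutions `fhat` clipped from below at `Q^ref`. -/
def iterate {H : ℕ} (M : MDP S A) (πref : Policy S A) (fhat : ℕ → QTuple S A H) :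
    ℕ → QTuple S A H
  | 0 => 0
  | k + 1 => fun h z => max (fhat k h z) (M.Q H πref h z)

/-- A run, on a probability space `(Ω, Pr)`, of the theoretical Cal-QL algorithm for `K` rounds with
`K` offline tuples per stage and one online tuple per stage and round. The σ-algebra `ℱ k` is the
information available before round `k`. No assumption is made on the dependence between tuples of
different stages, so that the online tuples of one round may come from one trajectory. -/
structure Run {Ω : Type*} {mΩ : MeasurableSpace Ω} (Pr : Measure Ω) {H : ℕ} (K : ℕ)
    (M : MDP S A) (C : FunClass S A H) (g : ArgmaxRule C) (πref : Policy S A)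
    (ν : Fin H → Measure (S × A)) where
  ℱ : Filtration ℕ mΩ
  /-- offline tuples -/
  off : Fin H → Fin K → Ω → Tuple S A
  /-- `onl k h`: online tuple of stage `h` collected in round `k` -/
  onl : ℕ → Fin H → Ω → Tuple S A
  /-- `fhat k`: regression solutions computed at the end of round `k` -/
  fhat : ℕ → Ω → QTuple S A H
  off_measurable : ∀ h i, Measurable[ℱ 0] (off h i)
  off_law : ∀ h i, Pr.map (off h i) = M.tupleLaw (ν h)
  off_indep : ∀ h, iIndepFun (off h) Pr
  onl_measurable : ∀ k < K, ∀ h, Measurable[ℱ (k + 1)] (onl k h)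
  /-- given the past, the tuple of stage `h` in round `k` has `(s,a) ∼ d_h^{π^k}` -/
  onl_law : ∀ k < K, ∀ (h : Fin H) (B : Set (Tuple S A)), MeasurableSet B →
    Pr⟦onl k h ⁻¹' B | ℱ k⟧ =ᵐ[Pr] fun ω =>
      (M.tupleLaw (M.occ (g.greedy (iterate M πref (fun j => fhat j ω) k)) h)).real B
  fhat_measurable : ∀ k < K, ∀ (h : Fin H) (f : S × A → ℝ),
    MeasurableSet[ℱ (k + 1)] {ω | fhat k ω h = f}
  fhat_mem : ∀ k < K, ∀ (h : Fin H) ω, fhat k ω h ∈ C h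
  fhat_argmin : ∀ k < K, ∀ (h : Fin H) ω, ∀ f ∈ C h,
    lsLoss (fun h i => off h i ω) (fun τ h => onl τ h ω) k h
        ((iterate M πref (fun j => fhat j ω) (k + 1)).at (h + 1)) (fhat k ω h)
      ≤ lsLoss (fun h i => off h i ω) (fun τ h => onl τ h ω) k h
        ((iterate M πref (fun j => fhat j ω) (k + 1)).at (h + 1)) f

/-- The policy `π^k` played in round `k`. -/
def Run.policy {Ω : Type*} {mΩ : MeasurableSpace Ω} {Pr : Measure Ω} {H K : ℕ}
    {M : MDP S A} {C : FunClass S A H} {g : ArgmaxRule C} {πref : Policy S A}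
    {ν : Fin H → Measure (S × A)} (r : Run Pr K M C g πref ν) (k : ℕ) (ω : Ω) : Policy S A :=
  g.greedy (iterate M πref (fun j => r.fhat j ω) k)

/-- Cumulative suboptimality `∑_k (V^{πe} - V^{π^k})`. -/
def Run.regret {Ω : Type*} {mΩ : MeasurableSpace Ω} {Pr : Measure Ω} {H K : ℕ}
    {M : MDP S A} {C : FunClass S A H} {g : ArgmaxRule C} {πref : Policy S A}
    {ν : Fin H → Measure (S × A)} (r : Run Pr K M C g πref ν) (πe : Policy S A) (ω : Ω) : ℝ :=
  ∑ k ∈ Finset.range K, (M.value H πe - M.value H (r.policy k ω))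

end

/-- The rate `H √(d K log(2 H K |F| / δ) log(1 + K))`. -/
def rate (H K d cardF : ℕ) (δ : ℝ) : ℝ :=
  H * Real.sqrt (d * K * Real.log (2 * H * K * cardF / δ) * Real.log (1 + K))

end

end CalQL

/-! Write `V^e - V^k = (V^e - E max f^k_0) + (E max f^k_0 - V^k)`, where `f^k` is the iterate whose
greedy policy is played. Telescoping Bellman errors along an occupancy measure
(`MDP.sum_integral_bellman_sub`) turns the second bracket into the on-policy Bellman errors of
`f^k`, exactly, because the policy is greedy (`MDP.sub_value_eq_sum`). It bounds the first bracket
by the Bellman errors with reversed sign along the comparator (`MDP.value_sub_le_sum`).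

These errors are small on the data already seen. For a fixed pair `(f, next)`, the excess squared
loss over the backup `T next` has conditional mean `(f - T next)^2` and a second moment dominated by
that mean, so it has a Bernstein-type exponential supermartingale
(`Run.lintegral_exp_logWeight_le`). Markov's inequality and a union bound over the finite class make
this uniform. By completeness the minimizer has nonpositive total excess, hence
`Run.exists_good_event`. Clipping at `Q^ref` moves the solution towards its target, which itself
dominates `Q^ref` (`Run.exists_hasSmallErrors`).

For the second bracket, bilinear rank makes the on-policy error an inner product whose past squares
sum to at most `b`; the elliptical potential argument (`sum_abs_inner_le`) then gives order `√(dK)`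
per stage. The first bracket has two bounds. The offline part of the error control and the transfer
coefficient give one (`Run.value_sub_le`). Calibration gives the other: the estimated value is at
least `V^ref` (`Run.refValue_le`). In this second bound only calibrated iterates occur, so the rank
of the calibrated class suffices. Round zero plays the greedy policy of `0` and is charged `Vmax`.
-/

namespace CalQL

/-! ### Value functions and their maxima over actions -/

section

variable {S A : Type*}

/-- The function `s ↦ max_a f(s,a)`. -/
noncomputable def supAct (f : S × A → ℝ) (s : S) : ℝ := ⨆ a, f (s, a)

lemma supAct_eq_of_isMax {f : S × A → ℝ} {σ : S → A} (h : ∀ s a, f (s, a) ≤ f (s, σ s)) (s : S) :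
    supAct f s = f (s, σ s) := by
  have : Nonempty A := ⟨σ s⟩
  apply le_antisymm (ciSup_le (h s))
  exact le_ciSup (f := fun a => f (s, a)) ⟨f (s, σ s), by rintro _ ⟨a, rfl⟩; exact h s a⟩ (σ s)

lemma supAct_zero (s : S) : supAct (0 : S × A → ℝ) s = 0 := by
  simp [supAct]

variable [MeasurableSpace S] [MeasurableSpace A]

/-- Measurable functions with values in `[0,B]` that have a measurable maximizing action. -/
structure IsValueFn (B : ℝ) (f : S × A → ℝ) : Prop where
  measurable : Measurable f
  mem_Icc : ∀ z, f z ∈ Set.Icc 0 B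
  exists_sel : ∃ σ : S → A, Measurable σ ∧ ∀ s a, f (s, a) ≤ f (s, σ s)

namespace IsValueFn

variable {B : ℝ} {f : S × A → ℝ}

lemma measurable_supAct (hf : IsValueFn B f) : Measurable (supAct f) := by
  obtain ⟨σ, hσ, h⟩ := hf.exists_sel
  rw [funext (supAct_eq_of_isMax h)]
  exact hf.measurable.comp (measurable_id.prodMk hσ)

lemma supAct_mem (hf : IsValueFn B f) (s : S) : supAct f s ∈ Set.Icc 0 B := by
  obtain ⟨σ, hσ, h⟩ := hf.exists_sel
  rw [supAct_eq_of_isMax h]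
  exact hf.mem_Icc _

lemma le_supAct (hf : IsValueFn B f) (z : S × A) : f z ≤ supAct f z.1 := by
  obtain ⟨σ, hσ, h⟩ := hf.exists_sel
  rw [supAct_eq_of_isMax h]
  exact h z.1 z.2

end IsValueFn

lemma integrable_of_mem_Icc {X : Type*} [MeasurableSpace X] {μ : Measure X} [IsFiniteMeasure μ]
    {f : X → ℝ} (hf : Measurable f) {a b : ℝ} (h : ∀ x, f x ∈ Set.Icc a b) : Integrable f μ :=
  Integrable.of_mem_Icc a b hf.aemeasurable (ae_of_all _ h)

lemma integral_mem_Icc {X : Type*} [MeasurableSpace X] {μ : Measure X} [IsProbabilityMeasure μ]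
    {f : X → ℝ} {a b : ℝ} (hi : Integrable f μ) (h : ∀ᵐ x ∂μ, f x ∈ Set.Icc a b) :
    ∫ x, f x ∂μ ∈ Set.Icc a b := by
  constructor
  · have := integral_mono_ae (μ := μ) (integrable_const a) hi (h.mono fun x hx => hx.1)
    simpa using this
  · have := integral_mono_ae (μ := μ) hi (integrable_const b) (h.mono fun x hx => hx.2)
    simpa using this

/-! ### Occupancy measures and telescoped Bellman errors -/

namespace MDP

variable (M : MDP S A) (π : Policy S A)

instance isMarkov_step (h : ℕ) : IsMarkovKernel (M.step π h) := by
  unfold MDP.step; infer_instance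

instance isMarkov_occFrom (n h : ℕ) : IsMarkovKernel (M.occFrom π n h) := by
  induction n generalizing h with
  | zero => unfold MDP.occFrom; infer_instance
  | succ n ih => unfold MDP.occFrom; have := ih (h + 1); infer_instance

instance isProb_occ (h : ℕ) : IsProbabilityMeasure (M.occ π h) := by
  induction h with
  | zero => unfold MDP.occ; infer_instance
  | succ n ih => unfold MDP.occ; infer_instance

lemma integrable_reward (z : S × A) : Integrable (fun r : ℝ => r) (M.R z) :=
  Integrable.of_mem_Icc 0 1 aemeasurable_id (M.reward_mem z)

lemma meanReward_mem (z : S × A) : M.meanReward z ∈ Set.Icc (0 : ℝ) 1 :=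
  integral_mem_Icc (M.integrable_reward z) (M.reward_mem z)

lemma measurable_meanReward : Measurable M.meanReward :=
  (StronglyMeasurable.integral_kernel (κ := M.R) (f := fun r : ℝ => r)
    stronglyMeasurable_id).measurable

lemma occ_bind_occFrom (n h : ℕ) :
    (M.occ π h).bind (M.occFrom π n h) = M.occ π (h + n) := by
  induction n generalizing h with
  | zero => simp [MDP.occFrom]
  | succ n ih =>
    rw [MDP.occFrom, ← Measure.comp_assoc, ← add_assoc, add_right_comm, ← ih (h + 1)]
    rfl

lemma integral_integral_kernel {X Y : Type*} [MeasurableSpace X] [MeasurableSpace Y] {μ : Measure X}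
    [IsFiniteMeasure μ] {κ : Kernel X Y} [IsMarkovKernel κ] {f : Y → ℝ} (hf : Measurable f)
    {a b : ℝ} (h : ∀ x, f x ∈ Set.Icc a b) :
    ∫ x, ∫ y, f y ∂(κ x) ∂μ = ∫ y, f y ∂(μ.bind κ) :=
  by
  have := ProbabilityTheory.Kernel.integral_comp (κ := Kernel.const Unit μ) (η := κ) (a := ())
    (f := f) (integrable_of_mem_Icc hf h)
  rw [Kernel.comp_apply, Kernel.const_apply] at this
  exact this.symm

lemma measurable_integral_occFrom (n h : ℕ) :
    Measurable fun z => ∫ w, M.meanReward w ∂(M.occFrom π n h z) :=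
  (StronglyMeasurable.integral_kernel M.measurable_meanReward.stronglyMeasurable).measurable

lemma integral_occFrom_mem (n h : ℕ) (z : S × A) :
    ∫ w, M.meanReward w ∂(M.occFrom π n h z) ∈ Set.Icc (0 : ℝ) 1 :=
  integral_mem_Icc (integrable_of_mem_Icc M.measurable_meanReward M.meanReward_mem)
    (ae_of_all _ M.meanReward_mem)

lemma value_eq_integral_Q (H : ℕ) : M.value H π = ∫ z, M.Q H π 0 z ∂(M.occ π 0) := by
  rw [MDP.occ, Measure.integral_compProd]
  · rfl
  · exact integrable_finsetSum _ fun n _ =>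
      integrable_of_mem_Icc (M.measurable_integral_occFrom π n 0) (M.integral_occFrom_mem π n 0)

lemma value_eq_sum (H : ℕ) :
    M.value H π = ∑ h ∈ Finset.range H, ∫ z, M.meanReward z ∂(M.occ π h) := by
  rw [value_eq_integral_Q]
  simp only [MDP.Q, Nat.sub_zero]
  rw [integral_finsetSum _ fun n _ =>
    integrable_of_mem_Icc (M.measurable_integral_occFrom π n 0) (M.integral_occFrom_mem π n 0)]
  refine Finset.sum_congr rfl fun n _ => ?_
  rw [integral_integral_kernel M.measurable_meanReward M.meanReward_mem, occ_bind_occFrom, zero_add]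

/-- Bellman equation of a policy. -/
lemma Q_eq_of_lt {H h : ℕ} (hh : h < H) (z : S × A) :
    M.Q H π h z = M.meanReward z + ∫ w, M.Q H π (h + 1) w ∂(M.step π h z) := by
  have e : H - h = (H - (h + 1)) + 1 := by omega
  simp only [MDP.Q]
  rw [e, Finset.sum_range_succ', add_comm, integral_finsetSum]
  · congr 1
    · simp only [MDP.occFrom, Kernel.id_apply]
      rw [integral_dirac' _ _ M.measurable_meanReward.stronglyMeasurable]
    · refine Finset.sum_congr rfl fun n _ => ?_
      rw [MDP.occFrom, Kernel.comp_apply]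
      exact (integral_integral_kernel M.measurable_meanReward M.meanReward_mem).symm
  · exact fun n _ => integrable_of_mem_Icc (M.measurable_integral_occFrom π n _)
      (M.integral_occFrom_mem π n _)

lemma Q_of_le {H h : ℕ} (hh : H ≤ h) (z : S × A) : M.Q H π h z = 0 := by
  simp [MDP.Q, Nat.sub_eq_zero_of_le hh]

lemma Q_nonneg (H h : ℕ) (z : S × A) : 0 ≤ M.Q H π h z :=
  Finset.sum_nonneg fun _ _ => integral_nonneg fun w => (M.meanReward_mem w).1

lemma value_nonneg (H : ℕ) : 0 ≤ M.value H π :=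
  integral_nonneg fun _ => integral_nonneg fun _ => M.Q_nonneg _ _ _ _

lemma bellman_eq (f : S × A → ℝ) (z : S × A) :
    M.bellman f z = M.meanReward z + ∫ s', supAct f s' ∂(M.P z) := rfl

variable {M π}

lemma measurable_bellman {B : ℝ} {f : S × A → ℝ} (hf : IsValueFn B f) :
    Measurable (M.bellman f) :=
  M.measurable_meanReward.add
    (StronglyMeasurable.integral_kernel hf.measurable_supAct.stronglyMeasurable).measurable

lemma integral_supAct_mem {B : ℝ} {f : S × A → ℝ} (hf : IsValueFn B f) (z : S × A) :
    ∫ s', supAct f s' ∂(M.P z) ∈ Set.Icc 0 B :=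
  integral_mem_Icc (integrable_of_mem_Icc hf.measurable_supAct hf.supAct_mem)
    (ae_of_all _ hf.supAct_mem)

lemma bellman_mem {B : ℝ} {f : S × A → ℝ} (hf : IsValueFn B f) (z : S × A) :
    M.bellman f z ∈ Set.Icc 0 (1 + B) := by
  have h1 := M.meanReward_mem z
  have h2 := integral_supAct_mem (M := M) hf z
  rw [bellman_eq]
  exact ⟨add_nonneg h1.1 h2.1, add_le_add h1.2 h2.2⟩

lemma bellman_zero (z : S × A) : M.bellman 0 z = M.meanReward z := by
  simp [bellman_eq, supAct_zero]

/-- `T f ≥ Q^π_h` when `f ≥ Q^π_{h+1}`. -/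
lemma Q_le_bellman {H h : ℕ} (hh : h < H) {B : ℝ} {f : S × A → ℝ} (hf : IsValueFn B f)
    (hQ : Measurable (M.Q H π (h + 1))) (hle : ∀ z, M.Q H π (h + 1) z ≤ f z) (z : S × A) :
    M.Q H π h z ≤ M.bellman f z := by
  have hs : Measurable fun w : S × A => supAct f w.1 := hf.measurable_supAct.comp measurable_fst
  have hsI : ∀ w : S × A, supAct f w.1 ∈ Set.Icc 0 B := fun w => hf.supAct_mem _
  have hQI : ∀ w, M.Q H π (h + 1) w ∈ Set.Icc 0 B := fun w =>
    ⟨M.Q_nonneg _ _ _ _, (hle w).trans (hf.mem_Icc w).2⟩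
  have e : ∫ w, supAct f w.1 ∂(M.step π h z) = ∫ s', supAct f s' ∂(M.P z) := by
    rw [MDP.step, ProbabilityTheory.integral_compProd (integrable_of_mem_Icc hs hsI)]
    simp
  rw [Q_eq_of_lt M π hh, bellman_eq, ← e]
  refine add_le_add le_rfl ?_
  refine integral_mono (μ := M.step π h z) (integrable_of_mem_Icc hQ hQI)
    (integrable_of_mem_Icc hs hsI) fun w => ?_
  exact (hle w).trans (hf.le_supAct w)

lemma integral_fst_occ_zero {u : S → ℝ} (hu : Measurable u) {a b : ℝ}
    (hI : ∀ s, u s ∈ Set.Icc a b) : ∫ z, u z.1 ∂(M.occ π 0) = ∫ s, u s ∂M.ρ := by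
  have hm : Measurable fun z : S × A => u z.1 := hu.comp measurable_fst
  rw [MDP.occ, Measure.integral_compProd (integrable_of_mem_Icc hm fun z => hI z.1)]
  simp

lemma integral_fst_occ_succ {u : S → ℝ} (hu : Measurable u) {a b : ℝ}
    (hI : ∀ s, u s ∈ Set.Icc a b) (h : ℕ) :
    ∫ z, u z.1 ∂(M.occ π (h + 1)) = ∫ z, ∫ s', u s' ∂(M.P z) ∂(M.occ π h) := by
  have hm : Measurable fun z : S × A => u z.1 := hu.comp measurable_fst
  rw [MDP.occ, ← integral_integral_kernel hm fun z => hI z.1]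
  refine integral_congr_ae (ae_of_all _ fun z => ?_)
  simp only
  rw [MDP.step, ProbabilityTheory.integral_compProd (integrable_of_mem_Icc hm fun z => hI z.1)]
  simp

/-- Telescoping the Bellman errors of `f` along the occupancy measures of `π`. -/
lemma sum_integral_bellman_sub {B : ℝ} {f : ℕ → S × A → ℝ} (hf : ∀ h, IsValueFn B (f h)) {H : ℕ}
    (hH : f H = 0) :
    ∑ h ∈ Finset.range H, ∫ z, (M.bellman (f (h + 1)) z - f h z) ∂(M.occ π h) =
      M.value H π - ∫ s, supAct (f 0) s ∂M.ρ
        + ∑ h ∈ Finset.range H, ∫ z, (supAct (f h) z.1 - f h z) ∂(M.occ π h) := by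
  have hI0 : ∀ h k, Integrable (f h) (M.occ π k) := fun h k =>
    integrable_of_mem_Icc (hf h).measurable (hf h).mem_Icc
  have hI1 : ∀ h k, Integrable (fun z => supAct (f h) z.1) (M.occ π k) := fun h k =>
    integrable_of_mem_Icc ((hf h).measurable_supAct.comp measurable_fst)
      fun z => (hf h).supAct_mem _
  have hI2 : ∀ h k, Integrable (fun z => ∫ s', supAct (f h) s' ∂(M.P z)) (M.occ π k) := fun h k =>
    integrable_of_mem_Icc
      (StronglyMeasurable.integral_kernel (hf h).measurable_supAct.stronglyMeasurable).measurable
      (integral_supAct_mem (hf h))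
  have hI3 : ∀ k, Integrable M.meanReward (M.occ π k) := fun k =>
    integrable_of_mem_Icc M.measurable_meanReward M.meanReward_mem
  -- Adding and subtracting `max_a f_h` splits a stage into the mean reward, a telescoping
  -- difference, and the loss of not acting greedily for `f_h`.
  have key : ∀ h, ∫ z, (M.bellman (f (h + 1)) z - f h z) ∂(M.occ π h) =
      ∫ z, M.meanReward z ∂(M.occ π h)
      + (∫ z, supAct (f (h + 1)) z.1 ∂(M.occ π (h + 1)) - ∫ z, supAct (f h) z.1 ∂(M.occ π h))
      + ∫ z, (supAct (f h) z.1 - f h z) ∂(M.occ π h) := by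
    intro h
    rw [integral_sub (hI1 _ _) (hI0 _ _), integral_fst_occ_succ (hf (h + 1)).measurable_supAct
      (hf (h + 1)).supAct_mem]
    simp only [bellman_eq]
    have hI4 : Integrable (fun z => M.meanReward z + ∫ s', supAct (f (h + 1)) s' ∂(M.P z))
      (M.occ π h) := (hI3 h).add (hI2 _ _)
    rw [integral_sub hI4 (hI0 _ _), integral_add (hI3 h) (hI2 _ _)]
    ring
  rw [Finset.sum_congr rfl fun h _ => key h, Finset.sum_add_distrib, Finset.sum_add_distrib,
    Finset.sum_range_sub (fun h => ∫ z, supAct (f h) z.1 ∂(M.occ π h)), value_eq_sum,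
    integral_fst_occ_zero (hf 0).measurable_supAct (hf 0).supAct_mem, hH]
  simp only [supAct_zero, integral_zero]
  ring

/-- The greedy gaps left by the telescoping are nonnegative for every policy and can be dropped.
This serves the comparator. -/
lemma value_sub_le_sum {B : ℝ} {f : ℕ → S × A → ℝ} (hf : ∀ h, IsValueFn B (f h)) {H : ℕ}
    (hH : f H = 0) :
    M.value H π - ∫ s, supAct (f 0) s ∂M.ρ ≤
      ∑ h ∈ Finset.range H, ∫ z, (M.bellman (f (h + 1)) z - f h z) ∂(M.occ π h) := by
  rw [sum_integral_bellman_sub hf hH]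
  have : 0 ≤ ∑ h ∈ Finset.range H, ∫ z, (supAct (f h) z.1 - f h z) ∂(M.occ π h) :=
    Finset.sum_nonneg fun h _ => integral_nonneg fun z => sub_nonneg.2 ((hf h).le_supAct z)
  linarith

/-- The last kernel in the occupancy measure is a Dirac mass on the graph of `σ`. -/
lemma ae_occ_deterministic {σ : S → A} {h : ℕ} (hσ : Measurable σ)
    (hπ : π.act h = Kernel.deterministic σ hσ)
    {p : S × A → Prop} (hp : MeasurableSet {z | p z}) (hs : ∀ s, p (s, σ s)) :
    ∀ᵐ z ∂(M.occ π h), p z := by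
  cases h with
  | zero =>
    rw [MDP.occ, hπ]
    refine Measure.ae_compProd_of_ae_ae hp (ae_of_all _ fun s => ?_)
    rw [Kernel.deterministic_apply]
    exact (ae_dirac_iff (measurable_prodMk_left (x := s) hp)).2 (hs s)
  | succ h =>
    rw [MDP.occ]
    refine (Measure.ae_comp_iff hp).2 (ae_of_all _ fun z => ?_)
    rw [MDP.step, hπ]
    refine Kernel.ae_compProd_of_ae_ae hp (ae_of_all _ fun s => ?_)
    rw [Kernel.prodMkLeft_apply, Kernel.deterministic_apply]
    exact (ae_dirac_iff (measurable_prodMk_left (x := s) hp)).2 (hs s)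

/-- For the greedy policy the gaps vanish almost everywhere, so the telescoping becomes an identity
for the overestimation of its value. -/
lemma sub_value_eq_sum {B : ℝ} {f : ℕ → S × A → ℝ} (hf : ∀ h, IsValueFn B (f h)) {H : ℕ}
    (hH : f H = 0) {σ : ℕ → S → A} (hσ : ∀ h, Measurable (σ h))
    (hmax : ∀ h < H, ∀ s a, f h (s, a) ≤ f h (s, σ h s))
    (hπ : ∀ h, π.act h = Kernel.deterministic (σ h) (hσ h)) :
    ∫ s, supAct (f 0) s ∂M.ρ - M.value H π =
      ∑ h ∈ Finset.range H, ∫ z, (f h z - M.bellman (f (h + 1)) z) ∂(M.occ π h) := by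
  have h0 : ∑ h ∈ Finset.range H, ∫ z, (supAct (f h) z.1 - f h z) ∂(M.occ π h) = 0 := by
    refine Finset.sum_eq_zero fun h hh => ?_
    refine integral_eq_zero_of_ae ?_
    refine ae_occ_deterministic (p := fun z => supAct (f h) z.1 - f h z = 0) (hσ h) (hπ h) ?_ ?_
    · exact measurableSet_eq_fun (((hf h).measurable_supAct.comp measurable_fst).sub
        (hf h).measurable) measurable_const
    · intro s
      rw [supAct_eq_of_isMax (hmax h (Finset.mem_range.1 hh)), sub_self]
  have := sum_integral_bellman_sub (M := M) (π := π) hf hH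
  rw [h0, add_zero] at this
  rw [← neg_sub, ← this, ← Finset.sum_neg_distrib]
  refine Finset.sum_congr rfl fun h _ => ?_
  rw [← integral_neg]
  simp

end MDP

end

/-! ### Exponential moments of the excess loss, and conditional laws -/

lemma exp_neg_le_of_abs_le {u : ℝ} (hu : |u| ≤ 1) : Real.exp (-u) ≤ 1 - u + u ^ 2 := by
  have h := Real.abs_exp_sub_one_sub_id_le (x := -u) (by rwa [abs_neg])
  have := (abs_le.1 h).2
  nlinarith

section

variable {S A : Type*} [MeasurableSpace S] [MeasurableSpace A]

/-- Excess squared temporal-difference error of `f` over the Bellman backup of `next`. -/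
noncomputable def excess (M : MDP S A) (f next : S × A → ℝ) (x : Tuple S A) : ℝ :=
  tdSq f next x - tdSq (M.bellman next) next x

instance isProb_tupleLaw (M : MDP S A) (μ : Measure (S × A)) [IsProbabilityMeasure μ] :
    IsProbabilityMeasure (M.tupleLaw μ) := by
  unfold MDP.tupleLaw; infer_instance

variable {M : MDP S A} {V : ℝ} {f next : S × A → ℝ}

/-- The factor `f - T next` is what makes the second moment of the excess proportional to its mean.
-/
lemma excess_eq (x : Tuple S A) : excess M f next x =
    (f x.1 - M.bellman next x.1) *
      (f x.1 + M.bellman next x.1 - 2 * (x.2.1 + supAct next x.2.2)) := by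
  unfold excess tdSq supAct
  ring

lemma measurable_excess (hf : IsValueFn V f) (hn : IsValueFn V next) :
    Measurable (excess M f next) := by
  have h1 := hf.measurable
  have h2 := M.measurable_bellman hn
  have h3 := hn.measurable_supAct
  rw [funext excess_eq]
  fun_prop

/-- Conditional mean of the excess error. -/
lemma integral_excess_fiber (hn : IsValueFn V next) (z : S × A) :
    ∫ y, excess M f next (z, y) ∂((M.R ×ₖ M.P) z) = (f z - M.bellman next z) ^ 2 := by
  have hs : Integrable (supAct next) (M.P z) :=
    integrable_of_mem_Icc hn.measurable_supAct hn.supAct_mem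
  have hs' : Integrable (fun y : ℝ × S => supAct next y.2) ((M.R z).prod (M.P z)) :=
    hs.comp_snd (M.R z)
  have hr' : Integrable (fun y : ℝ × S => y.1) ((M.R z).prod (M.P z)) :=
    (M.integrable_reward z).comp_fst (M.P z)
  -- The regression target has conditional mean `T next`, so the second factor of the excess
  -- averages to `f - T next` as well.
  have hsum : ∫ y : ℝ × S, (y.1 + supAct next y.2) ∂((M.R z).prod (M.P z)) = M.bellman next z := by
    rw [integral_add hr' hs', integral_fun_fst (fun r : ℝ => r), integral_fun_snd]
    simp [MDP.bellman_eq, MDP.meanReward]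
  have hI : Integrable (fun y : ℝ × S => 2 * (y.1 + supAct next y.2)) ((M.R z).prod (M.P z)) :=
    (hr'.add hs').const_mul 2
  simp only [excess_eq, Kernel.prod_apply]
  rw [integral_const_mul, integral_sub (integrable_const _) hI,
    integral_const_mul, hsum]
  simp
  ring

lemma ae_tupleLaw_reward_mem (M : MDP S A) (μ : Measure (S × A)) [IsProbabilityMeasure μ] :
    ∀ᵐ x ∂(M.tupleLaw μ), x.2.1 ∈ Set.Icc (0 : ℝ) 1 := by
  refine Measure.ae_compProd_of_ae_ae ?_ (ae_of_all _ fun z => ?_)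
  · exact (measurable_fst.comp measurable_snd) measurableSet_Icc
  · rw [Kernel.prod_apply]
    exact Measure.quasiMeasurePreserving_fst.ae (M.reward_mem z)

/-- One-step exponential moment bound for the excess error. -/
lemma lintegral_exp_excess_le (hf : IsValueFn V f) (hn : IsValueFn V next)
    (hT : ∀ z, M.bellman next z ∈ Set.Icc 0 V) (μ : Measure (S × A)) [IsProbabilityMeasure μ] :
    ∫⁻ x, ENNReal.ofReal (Real.exp (-(excess M f next x / (8 * (1 + V) ^ 2)))) ∂(M.tupleLaw μ) ≤
      ENNReal.ofReal
        (Real.exp (-((∫ z, (f z - M.bellman next z) ^ 2 ∂μ) / (16 * (1 + V) ^ 2)))) := by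
  have hmT := M.measurable_bellman hn
  have hmf := hf.measurable
  have hmD : Measurable (excess M f next) := measurable_excess hf hn
  obtain ⟨z0⟩ : Nonempty (S × A) := μ.nonempty_of_neZero
  have hV : 0 ≤ V := (hT z0).1.trans (hT z0).2
  -- Chosen so that `lam ^ 2 * (4 * (1 + V) ^ 2) = lam / 2`: the quadratic term of the exponential
  -- then consumes only half of the linear one, while the exponent stays within `[-1, 1]`.
  set lam : ℝ := 1 / (8 * (1 + V) ^ 2) with hlam
  have hlam0 : 0 < lam := by positivity
  have hlamB : lam * (8 * (1 + V) ^ 2) = 1 := by rw [hlam]; field_simp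
  have hbound : ∀ᵐ x ∂(M.tupleLaw μ), |excess M f next x| ≤ 8 * (1 + V) ^ 2 ∧
      excess M f next x ^ 2 ≤ 4 * (1 + V) ^ 2 * (f x.1 - M.bellman next x.1) ^ 2 := by
    filter_upwards [ae_tupleLaw_reward_mem M μ] with x hx
    have a1 := hf.mem_Icc x.1
    have a2 := hT x.1
    have a3 := hn.supAct_mem x.2.2
    have a4 := hx
    simp only [Set.mem_Icc] at a1 a2 a3 a4
    have b1 : |f x.1 + M.bellman next x.1 - 2 * (x.2.1 + supAct next x.2.2)| ≤ 2 * (1 + V) := by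
      rw [abs_le]; constructor <;> linarith
    have b2 : |f x.1 - M.bellman next x.1| ≤ 1 + V := by
      rw [abs_le]; constructor <;> linarith
    rw [excess_eq]
    constructor
    · rw [abs_mul]
      calc _ ≤ (1 + V) * (2 * (1 + V)) := by gcongr
        _ ≤ _ := by nlinarith
    · rw [mul_pow, mul_comm]
      refine mul_le_mul_of_nonneg_right ?_ (sq_nonneg _)
      calc _ ≤ (2 * (1 + V)) ^ 2 := sq_le_sq' (by linarith [(abs_le.1 b1).1]) (abs_le.1 b1).2
        _ = _ := by ring
  have hID : Integrable (excess M f next) (M.tupleLaw μ) :=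
    Integrable.of_mem_Icc (-(8 * (1 + V) ^ 2)) (8 * (1 + V) ^ 2) hmD.aemeasurable
      (hbound.mono fun x hx => abs_le.1 hx.1)
  have hgI : ∀ z, (f z - M.bellman next z) ^ 2 ∈ Set.Icc 0 (V ^ 2) := fun z => by
    have a1 := hf.mem_Icc z
    have a2 := hT z
    simp only [Set.mem_Icc] at a1 a2
    exact ⟨sq_nonneg _, sq_le_sq' (by linarith) (by linarith)⟩
  have hIg : Integrable (fun z => (f z - M.bellman next z) ^ 2) μ :=
    integrable_of_mem_Icc ((hmf.sub hmT).pow_const 2) hgI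
  have hmg' : Measurable fun x : Tuple S A => (f x.1 - M.bellman next x.1) ^ 2 := by fun_prop
  have hIg' : Integrable (fun x : Tuple S A => (f x.1 - M.bellman next x.1) ^ 2) (M.tupleLaw μ) :=
    integrable_of_mem_Icc hmg' fun x => hgI x.1
  have e1 : ∫ x, excess M f next x ∂(M.tupleLaw μ) = ∫ z, (f z - M.bellman next z) ^ 2 ∂μ := by
    unfold MDP.tupleLaw at hID ⊢
    rw [Measure.integral_compProd hID]
    simp only [integral_excess_fiber hn]
  have e2 : ∫ x, (f x.1 - M.bellman next x.1) ^ 2 ∂(M.tupleLaw μ) =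
      ∫ z, (f z - M.bellman next z) ^ 2 ∂μ := by
    unfold MDP.tupleLaw at hIg' ⊢
    rw [Measure.integral_compProd hIg']
    simp
  set E := ∫ z, (f z - M.bellman next z) ^ 2 ∂μ
  have hIu : Integrable (fun x : Tuple S A => 1 - lam * excess M f next x
      + lam / 2 * (f x.1 - M.bellman next x.1) ^ 2) (M.tupleLaw μ) :=
    ((integrable_const 1).sub (hID.const_mul lam)).add (hIg'.const_mul (lam / 2))
  have hle : ∀ᵐ x ∂(M.tupleLaw μ), Real.exp (-(excess M f next x / (8 * (1 + V) ^ 2))) ≤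
      1 - lam * excess M f next x + lam / 2 * (f x.1 - M.bellman next x.1) ^ 2 := by
    filter_upwards [hbound] with x hx
    have e : excess M f next x / (8 * (1 + V) ^ 2) = lam * excess M f next x := by
      rw [hlam]; ring
    rw [e]
    refine (exp_neg_le_of_abs_le ?_).trans ?_
    · rw [abs_mul, abs_of_pos hlam0, ← hlamB]
      exact mul_le_mul_of_nonneg_left hx.1 hlam0.le
    · have : (lam * excess M f next x) ^ 2 ≤
          lam / 2 * (f x.1 - M.bellman next x.1) ^ 2 := by
        calc (lam * excess M f next x) ^ 2 = lam ^ 2 * excess M f next x ^ 2 := by ring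
          _ ≤ lam ^ 2 * (4 * (1 + V) ^ 2 * (f x.1 - M.bellman next x.1) ^ 2) := by
            gcongr; exact hx.2
          _ = lam / 2 * (lam * (8 * (1 + V) ^ 2)) * (f x.1 - M.bellman next x.1) ^ 2 := by ring
          _ = _ := by rw [hlamB, mul_one]
      linarith
  calc _ ≤ ∫⁻ x, ENNReal.ofReal (1 - lam * excess M f next x
        + lam / 2 * (f x.1 - M.bellman next x.1) ^ 2) ∂(M.tupleLaw μ) :=
        lintegral_mono_ae (hle.mono fun x hx => ENNReal.ofReal_le_ofReal hx)
    _ = ENNReal.ofReal (∫ x, (1 - lam * excess M f next x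
        + lam / 2 * (f x.1 - M.bellman next x.1) ^ 2) ∂(M.tupleLaw μ)) :=
        (ofReal_integral_eq_lintegral_ofReal hIu
          (hle.mono fun x hx => (Real.exp_pos _).le.trans hx)).symm
    _ ≤ _ := by
      apply ENNReal.ofReal_le_ofReal
      have hI1 : Integrable (fun x => 1 - lam * excess M f next x) (M.tupleLaw μ) :=
        (integrable_const 1).sub (hID.const_mul lam)
      rw [integral_add hI1 (hIg'.const_mul (lam / 2)),
        integral_sub (integrable_const 1) (hID.const_mul lam), integral_const_mul,
        integral_const_mul, e1, e2]
      have e3 : E / (16 * (1 + V) ^ 2) = lam / 2 * E := by rw [hlam]; field_simp; ring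
      rw [e3]
      have := Real.add_one_le_exp (-(lam / 2 * E))
      simp only [integral_const, probReal_univ, smul_eq_mul, mul_one]
      linarith

end

/-- If `κ` is the conditional law of `X` given `m`, then factors measurable with respect to `m` can
be pulled out of the integral of a function of `X`. -/
lemma lintegral_mul_comp_eq_of_condLaw {Ω T : Type*} {m mΩ : MeasurableSpace Ω}
    [MeasurableSpace T] {Pr : Measure Ω} [IsProbabilityMeasure Pr] (hm : m ≤ mΩ) {X : Ω → T}
    (hX : Measurable X) {κ : Ω → Measure T} (hκ : Measurable[m] κ)
    (hκP : ∀ ω, IsProbabilityMeasure (κ ω))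
    (hlaw : ∀ B, MeasurableSet B → Pr⟦X ⁻¹' B | m⟧ =ᵐ[Pr] fun ω => (κ ω).real B)
    {Z : Ω → ℝ≥0∞} (hZ : Measurable[m] Z) {G : T → ℝ≥0∞} (hG : Measurable G) :
    ∫⁻ ω, Z ω * G (X ω) ∂Pr = ∫⁻ ω, Z ω * ∫⁻ x, G x ∂(κ ω) ∂Pr := by
  have hκ' : Measurable κ := hκ.mono hm le_rfl
  -- The conditional law is first tested on intersections of an `m`-event with an event of `X`;
  -- indicators are then replaced by general `Z` and afterwards by general `G`.
  have hset : ∀ A, MeasurableSet[m] A → ∀ B, MeasurableSet B →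
      Pr (A ∩ X ⁻¹' B) = ∫⁻ ω in A, κ ω B ∂Pr := by
    intro A hA B hB
    have hXB : MeasurableSet (X ⁻¹' B) := hX hB
    have h1 := setIntegral_condExp hm
      ((integrable_const (1 : ℝ)).indicator hXB : Integrable _ Pr) hA
    have h2 : ∫ ω in A, (Pr⟦X ⁻¹' B | m⟧) ω ∂Pr = ∫ ω in A, (κ ω).real B ∂Pr :=
      integral_congr_ae (ae_restrict_of_ae (hlaw B hB))
    rw [h2, integral_indicator hXB, Measure.restrict_restrict hXB] at h1
    simp only [integral_const, smul_eq_mul, mul_one, measureReal_restrict_apply_univ] at h1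
    have hκB : Measurable fun ω => κ ω B := Measure.measurable_measure.1 hκ' B hB
    have h3 : ∫ ω in A, (κ ω).real B ∂Pr = (∫⁻ ω in A, κ ω B ∂Pr).toReal :=
      integral_toReal hκB.aemeasurable (ae_of_all _ fun ω => measure_lt_top _ _)
    have h4 : ∫⁻ ω in A, κ ω B ∂Pr ≠ ∞ := by
      refine ne_of_lt (lt_of_le_of_lt (lintegral_mono fun ω => prob_le_one (μ := κ ω)) ?_)
      simp
    rw [h3, measureReal_def, Set.inter_comm] at h1
    exact ((ENNReal.toReal_eq_toReal_iff' h4 (measure_ne_top _ _)).1 h1).symm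
  have hpull : ∀ B, MeasurableSet B →
      ∫⁻ ω, Z ω * (X ⁻¹' B).indicator 1 ω ∂Pr = ∫⁻ ω, Z ω * κ ω B ∂Pr := by
    intro B hB
    have hXB : MeasurableSet (X ⁻¹' B) := hX hB
    have hi : Measurable ((X ⁻¹' B).indicator (1 : Ω → ℝ≥0∞)) := measurable_one.indicator hXB
    have hκB : Measurable fun ω => κ ω B := Measure.measurable_measure.1 hκ' B hB
    have hmul₁ : ∀ W : Ω → ℝ≥0∞, Measurable W →
        Measurable fun ω => W ω * (X ⁻¹' B).indicator (1 : Ω → ℝ≥0∞) ω := fun _ hW => hW.mul hi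
    have hmul₂ : ∀ W : Ω → ℝ≥0∞, Measurable W → Measurable fun ω => W ω * κ ω B :=
      fun _ hW => hW.mul hκB
    refine Measurable.ennreal_induction (mα := m) (motive := fun Z =>
      ∫⁻ ω, Z ω * (X ⁻¹' B).indicator 1 ω ∂Pr = ∫⁻ ω, Z ω * κ ω B ∂Pr) ?_ ?_ ?_ hZ
    · intro c A hA
      have hA' := hm _ hA
      have e1 : (fun ω => A.indicator (fun _ => c) ω * (X ⁻¹' B).indicator 1 ω)
          = fun ω => c * (A ∩ X ⁻¹' B).indicator 1 ω := by
        funext ω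
        by_cases h1 : ω ∈ A <;> by_cases h2 : ω ∈ X ⁻¹' B <;> simp [h1, h2]
      have e2 : (fun ω => A.indicator (fun _ => c) ω * κ ω B)
          = fun ω => c * A.indicator (fun ω => κ ω B) ω := by
        funext ω
        by_cases h1 : ω ∈ A <;> simp [h1]
      rw [e1, e2, lintegral_const_mul _ (measurable_one.indicator (hA'.inter hXB)),
        lintegral_const_mul _ (hκB.indicator hA'), lintegral_indicator_one (hA'.inter hXB),
        lintegral_indicator hA', hset A hA B hB]
    · intro f g _ hf hg ihf ihg
      have hf' := hf.mono hm le_rfl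
      simp only [Pi.add_apply, add_mul]
      rw [lintegral_add_left (hmul₁ f hf'), lintegral_add_left (hmul₂ f hf'), ihf, ihg]
    · intro f hf hmono ih
      have hf' := fun n => (hf n).mono hm le_rfl
      simp only [ENNReal.iSup_mul]
      rw [lintegral_iSup (fun n => hmul₁ _ (hf' n)), lintegral_iSup (fun n => hmul₂ _ (hf' n))]
      · exact iSup_congr ih
      · exact fun i j hij ω => mul_le_mul_left (hmono hij ω) _
      · exact fun i j hij ω => mul_le_mul_left (hmono hij ω) _
  have hZ' : Measurable Z := hZ.mono hm le_rfl
  -- Using `Z` as a density turns the identity for sets into an equality of measures on `T`, against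
  -- which any `G` can be integrated.
  have hmeas : (Pr.withDensity Z).map X = (Pr.withDensity Z).bind κ := by
    ext B hB
    have hXB : MeasurableSet (X ⁻¹' B) := hX hB
    rw [Measure.map_apply hX hB, Measure.bind_apply hB hκ'.aemeasurable,
      withDensity_apply _ hXB, lintegral_withDensity_eq_lintegral_mul _ hZ'
        (Measure.measurable_measure.1 hκ' B hB)]
    simp only [Pi.mul_apply]
    rw [← hpull B hB, ← lintegral_indicator hXB]
    refine lintegral_congr fun ω => ?_
    by_cases h : ω ∈ X ⁻¹' B <;> simp [h]
  have h1 : ∫⁻ x, G x ∂((Pr.withDensity Z).map X) = ∫⁻ ω, Z ω * G (X ω) ∂Pr := by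
    have hGX : Measurable fun ω => G (X ω) := hG.comp hX
    rw [lintegral_map hG hX, lintegral_withDensity_eq_lintegral_mul _ hZ' hGX]
    rfl
  have h2 : ∫⁻ x, G x ∂((Pr.withDensity Z).bind κ) = ∫⁻ ω, Z ω * ∫⁻ x, G x ∂(κ ω) ∂Pr := by
    have hGκ : Measurable fun ω => ∫⁻ x, G x ∂(κ ω) := (Measure.measurable_lintegral hG).comp hκ'
    rw [Measure.lintegral_bind hκ'.aemeasurable hG.aemeasurable,
      lintegral_withDensity_eq_lintegral_mul _ hZ' hGκ]
    rfl
  rw [← h1, hmeas, h2]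

/-! ### The exponential supermartingale of a run and uniform concentration -/

section

variable {S A Ω : Type*} [MeasurableSpace S] [MeasurableSpace A] {mΩ : MeasurableSpace Ω}
  {Pr : Measure Ω} {H K : ℕ} {M : MDP S A} {C : FunClass S A H}
  {g : ArgmaxRule C} {πref : Policy S A} {ν : Fin H → Measure (S × A)}

/-- The Q-function `f^k` of round `k`. -/
noncomputable def Run.iter (r : Run Pr K M C g πref ν) (k : ℕ) (ω : Ω) : QTuple S A H :=
  iterate M πref (fun j => r.fhat j ω) k

/-- The regression solution takes finitely many values with measurable level sets, so `Φ` may be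
arbitrary and no σ-algebra on Q-functions is needed. -/
lemma Run.measurable_fhat_comp (r : Run Pr K M C g πref ν) {k : ℕ} (hk : k < K) {X : Type*}
    [MeasurableSpace X] (Φ : QTuple S A H → X) :
    Measurable[r.ℱ (k + 1)] fun ω => Φ (r.fhat k ω) := by
  classical
  intro B _
  have : (fun ω => Φ (r.fhat k ω)) ⁻¹' B =
      ⋃ f ∈ (Fintype.piFinset C).filter fun f => Φ f ∈ B, ⋂ h, {ω | r.fhat k ω h = f h} := by
    ext ω
    simp only [Set.mem_preimage, Finset.mem_filter, Fintype.mem_piFinset, Set.mem_iUnion,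
      Set.mem_iInter, Set.mem_ofPred_eq, exists_prop]
    constructor
    · exact fun hB => ⟨r.fhat k ω, ⟨fun h => r.fhat_mem k hk h ω, hB⟩, fun h => rfl⟩
    · rintro ⟨f, ⟨_, hB⟩, hf⟩
      rwa [funext hf]
  rw [this]
  exact Finset.measurableSet_biUnion _ fun f _ =>
    MeasurableSet.iInter fun h => r.fhat_measurable k hk h (f h)

lemma Run.measurable_iter_comp (r : Run Pr K M C g πref ν) {k : ℕ} (hk : k ≤ K) {X : Type*}
    [MeasurableSpace X] (Φ : QTuple S A H → X) :
    Measurable[r.ℱ k] fun ω => Φ (r.iter k ω) := by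
  cases k with
  | zero => exact (measurable_const : Measurable[r.ℱ 0] fun _ : Ω => Φ 0)
  | succ k =>
    exact r.measurable_fhat_comp hk fun f => Φ fun h z => max (f h z) (M.Q H πref h z)

/-- Logarithm of the exponential supermartingale that controls the Bellman error of `f` with
next-step function `next` on the data of stage `h`. -/
noncomputable def Run.logWeight (r : Run Pr K M C g πref ν) (V : ℝ) (h : Fin H)
    (f next : S × A → ℝ) (k : ℕ) (ω : Ω) : ℝ :=
  (K * ∫ z, (f z - M.bellman next z) ^ 2 ∂(ν h) + ∑ τ ∈ Finset.range k,
      ∫ z, (f z - M.bellman next z) ^ 2 ∂(M.occ (g.greedy (r.iter τ ω)) h)) / (16 * (1 + V) ^ 2)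
    - (∑ i, excess M f next (r.off h i ω)
        + ∑ τ ∈ Finset.range k, excess M f next (r.onl τ h ω)) / (8 * (1 + V) ^ 2)

lemma Run.logWeight_succ (r : Run Pr K M C g πref ν) (V : ℝ) (h : Fin H)
    (f next : S × A → ℝ) (k : ℕ) (ω : Ω) :
    r.logWeight V h f next (k + 1) ω = r.logWeight V h f next k ω
      + (∫ z, (f z - M.bellman next z) ^ 2 ∂(M.occ (g.greedy (r.iter k ω)) h))
        / (16 * (1 + V) ^ 2)
      - excess M f next (r.onl k h ω) / (8 * (1 + V) ^ 2) := by
  simp only [Run.logWeight, Finset.sum_range_succ]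
  ring

variable {V : ℝ} {f next : S × A → ℝ}

lemma Run.measurable_logWeight (r : Run Pr K M C g πref ν) (h : Fin H)
    (hf : IsValueFn V f) (hn : IsValueFn V next) {k : ℕ} (hk : k ≤ K) :
    Measurable[r.ℱ k] (r.logWeight V h f next k) := by
  have hmD := measurable_excess (M := M) hf hn
  have h1 : Measurable[r.ℱ k] fun ω => ∑ τ ∈ Finset.range k,
      ∫ z, (f z - M.bellman next z) ^ 2 ∂(M.occ (g.greedy (r.iter τ ω)) h) := by
    refine Finset.measurable_sum _ fun τ hτ => ?_
    have hτ' := Finset.mem_range.1 hτ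
    exact (r.measurable_iter_comp (by omega : τ ≤ K) fun q =>
      ∫ z, (f z - M.bellman next z) ^ 2 ∂(M.occ (g.greedy q) h)).mono (r.ℱ.mono hτ'.le) le_rfl
  have h2 : Measurable[r.ℱ k] fun ω => ∑ i, excess M f next (r.off h i ω) :=
    Finset.measurable_sum _ fun i _ =>
      hmD.comp ((r.off_measurable h i).mono (r.ℱ.mono (Nat.zero_le k)) le_rfl)
  have h3 : Measurable[r.ℱ k] fun ω => ∑ τ ∈ Finset.range k, excess M f next (r.onl τ h ω) := by
    refine Finset.measurable_sum _ fun τ hτ => ?_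
    have hτ' := Finset.mem_range.1 hτ
    exact hmD.comp ((r.onl_measurable τ (by omega) h).mono (r.ℱ.mono hτ') le_rfl)
  exact ((h1.const_add _).div_const _).sub ((h2.add h3).div_const _)

/-- The independent offline tuples give a product whose factors are compensated one by one. Each
online round then contributes a factor of conditional mean at most one. -/
lemma Run.lintegral_exp_logWeight_le [IsProbabilityMeasure Pr] [∀ h, IsProbabilityMeasure (ν h)]
    (r : Run Pr K M C g πref ν) (h : Fin H) (hf : IsValueFn V f) (hn : IsValueFn V next)
    (hT : ∀ z, M.bellman next z ∈ Set.Icc 0 V) {k : ℕ} (hk : k ≤ K) :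
    ∫⁻ ω, ENNReal.ofReal (Real.exp (r.logWeight V h f next k ω)) ∂Pr ≤ 1 := by
  have hmD := measurable_excess (M := M) hf hn
  set G : Tuple S A → ℝ≥0∞ := fun x =>
    ENNReal.ofReal (Real.exp (-(excess M f next x / (8 * (1 + V) ^ 2)))) with hGdef
  have hG : Measurable G := (Real.measurable_exp.comp (hmD.div_const _).neg).ennreal_ofReal
  induction k with
  | zero =>
    have hoff : ∀ i, Measurable (r.off h i) := fun i => (r.off_measurable h i).mono (r.ℱ.le 0) le_rfl
    have e : ∀ ω, ENNReal.ofReal (Real.exp (r.logWeight V h f next 0 ω)) =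
        ENNReal.ofReal (Real.exp ((K * ∫ z, (f z - M.bellman next z) ^ 2 ∂(ν h))
          / (16 * (1 + V) ^ 2))) * ∏ i, G (r.off h i ω) := by
      intro ω
      rw [hGdef, ← ENNReal.ofReal_prod_of_nonneg fun i _ => (Real.exp_pos _).le,
        ← ENNReal.ofReal_mul (Real.exp_pos _).le, ← Real.exp_sum, ← Real.exp_add]
      congr 2
      simp only [Run.logWeight, Finset.range_zero, Finset.sum_empty, add_zero,
        Finset.sum_neg_distrib, Finset.sum_div]
      ring
    have hprod : Measurable fun ω => ∏ i, G (r.off h i ω) :=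
      Finset.measurable_prod _ fun i _ => hG.comp (hoff i)
    simp only [e]
    rw [lintegral_const_mul _ hprod,
      lintegral_prod_eq_prod_lintegral_of_indepFun Finset.univ (fun i ω => G (r.off h i ω))
        ((r.off_indep h).comp (fun _ => G) fun _ => hG) fun i => hG.comp (hoff i)]
    have e2 : ∀ i, ∫⁻ ω, G (r.off h i ω) ∂Pr ≤ ENNReal.ofReal
        (Real.exp (-((∫ z, (f z - M.bellman next z) ^ 2 ∂(ν h)) / (16 * (1 + V) ^ 2)))) := by
      intro i
      rw [← lintegral_map hG (hoff i), r.off_law h i]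
      exact lintegral_exp_excess_le hf hn hT (ν h)
    refine (mul_le_mul_right (Finset.prod_le_prod' fun i _ => e2 i) _).trans ?_
    rw [Finset.prod_const, Finset.card_univ, Fintype.card_fin,
      ← ENNReal.ofReal_pow (Real.exp_pos _).le, ← ENNReal.ofReal_mul (Real.exp_pos _).le,
      ← Real.exp_nat_mul, ← Real.exp_add]
    apply le_of_eq
    rw [ENNReal.ofReal_eq_one, Real.exp_eq_one_iff]
    ring
  | succ k ih =>
    have hk' : k < K := hk
    let e : Ω → ℝ := fun ω =>
      (∫ z, (f z - M.bellman next z) ^ 2 ∂(M.occ (g.greedy (r.iter k ω)) h)) / (16 * (1 + V) ^ 2)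
    have he : Measurable[r.ℱ k] e := r.measurable_iter_comp hk'.le fun q =>
      (∫ z, (f z - M.bellman next z) ^ 2 ∂(M.occ (g.greedy q) h)) / (16 * (1 + V) ^ 2)
    -- The compensator `e` of round `k` depends only on the policy, which is known beforehand; it
    -- joins the past weight, and only `G` is integrated against the conditional law.
    let Z : Ω → ℝ≥0∞ := fun ω => ENNReal.ofReal (Real.exp (r.logWeight V h f next k ω + e ω))
    have hZ : Measurable[r.ℱ k] Z :=
      (Real.measurable_exp.comp ((r.measurable_logWeight h hf hn hk'.le).add he)).ennreal_ofReal
    have e1 : ∀ ω, ENNReal.ofReal (Real.exp (r.logWeight V h f next (k + 1) ω)) =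
        Z ω * G (r.onl k h ω) := by
      intro ω
      rw [hGdef, ← ENNReal.ofReal_mul (Real.exp_pos _).le, ← Real.exp_add, Run.logWeight_succ]
      rfl
    simp only [e1]
    rw [lintegral_mul_comp_eq_of_condLaw (r.ℱ.le k)
      ((r.onl_measurable k hk' h).mono (r.ℱ.le _) le_rfl)
      (r.measurable_iter_comp hk'.le fun q => M.tupleLaw (M.occ (g.greedy q) h))
      (fun ω => inferInstance) (r.onl_law k hk' h) hZ hG]
    refine le_trans (lintegral_mono fun ω => ?_) (ih hk'.le)
    refine (mul_le_mul_right (lintegral_exp_excess_le hf hn hT _) _).trans (le_of_eq ?_)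
    rw [← ENNReal.ofReal_mul (Real.exp_pos _).le, ← Real.exp_add]
    simp [e]

variable (M πref C g) in
/-- The functions of the class are value functions, Bellman backups of the class stay in the class,
and the class is closed under calibration. -/
structure IsCompleteClass (V : ℝ) : Prop where
  valueFn : ∀ q : QTuple S A H, (∀ h, q h ∈ C h) → ∀ k, IsValueFn V (q.at k)
  bellman_mem : ∀ q : QTuple S A H, (∀ h, q h ∈ C h) →
    ∀ h : Fin H, M.bellman (q.at (h + 1)) ∈ C h
  max_mem : ∀ h : Fin H, ∀ f ∈ C h, (fun z => max (f z) (M.Q H πref h z)) ∈ C h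

lemma QTuple.at_val {X Y : Type*} {H : ℕ} (q : QTuple X Y H) (h : Fin H) : q.at h = q h := by
  simp [QTuple.at]

lemma QTuple.at_self {X Y : Type*} {H : ℕ} (q : QTuple X Y H) : q.at H = 0 := by
  simp [QTuple.at]

lemma Run.iter_succ_mem (r : Run Pr K M C g πref ν) (hC : IsCompleteClass M C πref V) {k : ℕ}
    (hk : k < K) (ω : Ω) (h : Fin H) : r.iter (k + 1) ω h ∈ C h :=
  hC.max_mem h _ (r.fhat_mem k hk h ω)

/-- By completeness the Bellman backup of the next-stage iterate is itself a competitor in the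
least-squares problem. -/
lemma Run.sum_excess_nonpos (r : Run Pr K M C g πref ν) (hC : IsCompleteClass M C πref V) {k : ℕ}
    (hk : k < K) (ω : Ω) (h : Fin H) :
    ∑ i, excess M (r.fhat k ω h) ((r.iter (k + 1) ω).at (h + 1)) (r.off h i ω)
      + ∑ τ ∈ Finset.range (k + 1),
        excess M (r.fhat k ω h) ((r.iter (k + 1) ω).at (h + 1)) (r.onl τ h ω) ≤ 0 := by
  have h1 := r.fhat_argmin k hk h ω _ (hC.bellman_mem _ (r.iter_succ_mem hC hk ω) h)
  simp only [lsLoss] at h1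
  simp only [excess, Finset.sum_sub_distrib]
  change _ + _ ≤ _ + _ at h1
  simp only [Run.iter] at h1 ⊢
  linarith

/-- Uniform control of the Bellman errors of the regression solutions. -/
theorem Run.exists_good_event [IsProbabilityMeasure Pr] [∀ h, IsProbabilityMeasure (ν h)]
    (r : Run Pr K M C g πref ν) (hC : IsCompleteClass M C πref V) (hV : 0 ≤ V)
    (hH : 0 < H) (hK : 0 < K) (hsize : 0 < C.size) {δ : ℝ} (hδ : 0 < δ) :
    ∃ G : Set Ω, MeasurableSet G ∧ 1 - δ ≤ Pr.real G ∧ ∀ ω ∈ G, ∀ h : Fin H, ∀ k < K,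
      K * ∫ z, (r.fhat k ω h z - M.bellman ((r.iter (k + 1) ω).at (h + 1)) z) ^ 2 ∂(ν h)
        + ∑ τ ∈ Finset.range (k + 1),
          ∫ z, (r.fhat k ω h z - M.bellman ((r.iter (k + 1) ω).at (h + 1)) z) ^ 2
            ∂(M.occ (g.greedy (r.iter τ ω)) h)
        ≤ 16 * (1 + V) ^ 2 * Real.log (H * K * C.size / δ) := by
  classical
  have hN : (0 : ℝ) < H * K * C.size := by positivity
  set N : ℝ := H * K * C.size with hNdef
  let I : Finset (Fin H × Fin K × QTuple S A H) :=
    Finset.univ ×ˢ Finset.univ ×ˢ Fintype.piFinset C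
  have hI : (I.card : ℝ) = N := by
    simp [I, hNdef, FunClass.size, Finset.card_product, mul_assoc]
  -- Markov's inequality at level `N / δ` gives each bad event probability at most `δ / N`, for `N`
  -- triples of stage, round and Q-function.
  let bad : Fin H × Fin K × QTuple S A H → Set Ω := fun i => {ω | ENNReal.ofReal (N / δ) ≤
    ENNReal.ofReal (Real.exp
      (r.logWeight V i.1 (i.2.2 i.1) (i.2.2.at (i.1 + 1)) (i.2.1 + 1) ω))}
  have hmem : ∀ i ∈ I, ∀ h, i.2.2 h ∈ C h := by
    intro i hi
    simpa [I] using hi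
  have hVF : ∀ i ∈ I, IsValueFn V (i.2.2 i.1) := fun i hi => by
    have := hC.valueFn _ (hmem i hi) i.1
    rwa [QTuple.at_val] at this
  have hmeas : ∀ i ∈ I, Measurable fun ω => ENNReal.ofReal (Real.exp
      (r.logWeight V i.1 (i.2.2 i.1) (i.2.2.at (i.1 + 1)) (i.2.1 + 1) ω)) := fun i hi =>
    (Real.measurable_exp.comp (((r.measurable_logWeight i.1 (hVF i hi)
      (hC.valueFn _ (hmem i hi) _) i.2.1.2)).mono (r.ℱ.le _) le_rfl)).ennreal_ofReal
  have hbad : ∀ i ∈ I, Pr (bad i) ≤ ENNReal.ofReal (δ / N) := by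
    intro i hi
    have h0 : ENNReal.ofReal (N / δ) ≠ 0 := by
      rw [Ne, ENNReal.ofReal_eq_zero, not_le]; positivity
    -- The backup is placed in component `i.1` of the tuple, so that its bounds can be read off from
    -- membership in the class.
    have hT : ∀ z, M.bellman (i.2.2.at (i.1 + 1)) z ∈ Set.Icc 0 V := by
      have hm := hC.bellman_mem _ (hmem i hi) i.1
      have := hC.valueFn (Function.update i.2.2 i.1 (M.bellman (i.2.2.at (i.1 + 1)))) (fun h => by
        by_cases e : h = i.1
        · subst e; simpa using hm
        · simpa [e] using hmem i hi h) i.1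
      rw [QTuple.at_val, Function.update_self] at this
      exact this.mem_Icc
    refine (meas_ge_le_lintegral_div (hmeas i hi).aemeasurable h0 ENNReal.ofReal_ne_top).trans ?_
    refine (ENNReal.div_le_div_right (r.lintegral_exp_logWeight_le i.1 (hVF i hi)
      (hC.valueFn _ (hmem i hi) _) hT i.2.1.2) _).trans ?_
    rw [one_div, ← ENNReal.ofReal_inv_of_pos (by positivity), inv_div]
  have hbadm : MeasurableSet (⋃ i ∈ I, bad i) :=
    Finset.measurableSet_biUnion _ fun i hi => measurableSet_le measurable_const (hmeas i hi)
  refine ⟨(⋃ i ∈ I, bad i)ᶜ, hbadm.compl, ?_, ?_⟩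
  · rw [probReal_compl_eq_one_sub hbadm]
    have h1 : Pr (⋃ i ∈ I, bad i) ≤ ENNReal.ofReal δ := by
      calc Pr (⋃ i ∈ I, bad i) ≤ ∑ i ∈ I, Pr (bad i) := measure_biUnion_finset_le _ _
        _ ≤ ∑ _i ∈ I, ENNReal.ofReal (δ / N) := Finset.sum_le_sum hbad
        _ = ENNReal.ofReal δ := by
          rw [Finset.sum_const, nsmul_eq_mul, ← ENNReal.ofReal_natCast,
            ← ENNReal.ofReal_mul (Nat.cast_nonneg _), hI]
          congr 1
          field_simp
    have h2 : Pr.real (⋃ i ∈ I, bad i) ≤ δ := ENNReal.toReal_le_of_le_ofReal hδ.le h1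
    linarith
  · intro ω hω h k hk
    -- The weight pairs the unclipped solution at stage `h` with the clipped iterate at stage `h +
    -- 1`. Both fit into one tuple of the class, so the union bound costs `C.size` and not its
    -- square.
    set q : QTuple S A H := Function.update (r.iter (k + 1) ω) h (r.fhat k ω h) with hq
    have hqC : ∀ h', q h' ∈ C h' := fun h' => by
      by_cases e : h' = h
      · subst e; simpa [hq] using r.fhat_mem k hk h' ω
      · simpa [hq, e] using r.iter_succ_mem hC hk ω h'
    have hqh : q h = r.fhat k ω h := by simp [hq]
    have hqn : q.at (h + 1) = (r.iter (k + 1) ω).at (h + 1) := by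
      unfold QTuple.at
      split_ifs with hh
      · rw [hq, Function.update_of_ne]
        intro e
        have := congrArg Fin.val e
        simp at this
      · rfl
    have hiI : (h, (⟨k, hk⟩ : Fin K), q) ∈ I := by simp [I, hqC]
    have hnb : ω ∉ bad (h, ⟨k, hk⟩, q) := fun hb => hω (Set.mem_biUnion hiI hb)
    simp only [bad, Set.mem_ofPred_eq, not_le, hqh, hqn] at hnb
    rw [ENNReal.ofReal_lt_ofReal_iff (by positivity), ← Real.lt_log_iff_exp_lt (by positivity)]
      at hnb
    have hs := r.sum_excess_nonpos hC hk ω h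
    rw [Run.logWeight] at hnb
    have h8 : (0 : ℝ) < 8 * (1 + V) ^ 2 := by positivity
    have hs' := div_nonpos_of_nonpos_of_nonneg hs h8.le
    have h16 : (0 : ℝ) < 16 * (1 + V) ^ 2 := by positivity
    have hfin := hnb.le.trans' (le_sub_self_iff _ |>.2 hs')
    rwa [div_le_iff₀' h16] at hfin

end

/-! ### Elliptical potential lemma -/

section EllipticalPotential

open Matrix

variable {d : ℕ}

/-- Regularized Gram matrix `lam I + ∑_{τ<k} x_τ x_τᵀ`. -/
noncomputable def gramMatrix (lam : ℝ) (x : ℕ → Fin d → ℝ) (k : ℕ) : Matrix (Fin d) (Fin d) ℝ :=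
  lam • (1 : Matrix (Fin d) (Fin d) ℝ) + ∑ τ ∈ Finset.range k, vecMulVec (x τ) (x τ)

variable {lam : ℝ} {x : ℕ → Fin d → ℝ}

lemma dotProduct_gramMatrix_mulVec (u v : Fin d → ℝ) (k : ℕ) :
    u ⬝ᵥ (gramMatrix lam x k *ᵥ v)
      = lam * (u ⬝ᵥ v) + ∑ τ ∈ Finset.range k, (x τ ⬝ᵥ u) * (x τ ⬝ᵥ v) := by
  simp only [gramMatrix, add_mulVec, smul_mulVec, one_mulVec, sum_mulVec, vecMulVec_mulVec,
    dotProduct_add, dotProduct_smul, smul_eq_mul, dotProduct_sum]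
  congr 1
  refine Finset.sum_congr rfl fun τ _ => ?_
  rw [dotProduct_comm u (x τ)]
  simp

lemma gramMatrix_isHermitian (k : ℕ) : (gramMatrix lam x k).IsHermitian := by
  ext i j
  simp [gramMatrix, Matrix.sum_apply, vecMulVec_apply, Matrix.one_apply, mul_comm, eq_comm]

lemma dotProduct_self_nonneg' (u : Fin d → ℝ) : 0 ≤ u ⬝ᵥ u :=
  Finset.sum_nonneg fun _ _ => mul_self_nonneg _

lemma gramMatrix_quad_ge (u : Fin d → ℝ) (k : ℕ) :
    lam * (u ⬝ᵥ u) ≤ u ⬝ᵥ (gramMatrix lam x k *ᵥ u) := by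
  rw [dotProduct_gramMatrix_mulVec]
  exact le_add_of_nonneg_right (Finset.sum_nonneg fun _ _ => mul_self_nonneg _)

lemma gramMatrix_posDef (hlam : 0 < lam) (k : ℕ) : (gramMatrix lam x k).PosDef := by
  refine PosDef.of_dotProduct_mulVec_pos (gramMatrix_isHermitian k) fun u hu => ?_
  rw [star_trivial]
  refine lt_of_lt_of_le (mul_pos hlam ?_) (gramMatrix_quad_ge u k)
  exact (dotProduct_self_nonneg' u).lt_of_ne' (by simpa [dotProduct_self_eq_zero] using hu)

/-- Squared norm of `x_k` in the metric of the inverse Gram matrix. -/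
noncomputable def potential (lam : ℝ) (x : ℕ → Fin d → ℝ) (k : ℕ) : ℝ :=
  x k ⬝ᵥ ((gramMatrix lam x k)⁻¹ *ᵥ x k)

lemma gramMatrix_mulVec_inv (hlam : 0 < lam) (k : ℕ) (u : Fin d → ℝ) :
    gramMatrix lam x k *ᵥ ((gramMatrix lam x k)⁻¹ *ᵥ u) = u := by
  rw [mulVec_mulVec, mul_nonsing_inv _ (gramMatrix_posDef hlam k).det_pos.ne'.isUnit, one_mulVec]

/-- Matrix determinant lemma for a rank-one update; it makes the sum of `log (1 + potential)`
telescope. -/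
lemma det_gramMatrix_succ (hlam : 0 < lam) (k : ℕ) :
    (gramMatrix lam x (k + 1)).det = (gramMatrix lam x k).det * (1 + potential lam x k) := by
  have h := det_add_replicateCol_mul_replicateRow (ι := Unit)
    (gramMatrix_posDef (x := x) hlam k).det_pos.ne'.isUnit (x k) (x k)
  rw [← vecMulVec_eq] at h
  have e : gramMatrix lam x (k + 1) = gramMatrix lam x k + vecMulVec (x k) (x k) := by
    simp only [gramMatrix, Finset.sum_range_succ, add_assoc]
  rw [e, h, det_unique (n := Unit), Matrix.add_apply, one_apply_eq, Matrix.mul_assoc,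
    ← replicateCol_mulVec, replicateRow_mul_replicateCol_apply]
  rfl

lemma potential_eq_quad (hlam : 0 < lam) (k : ℕ) :
    potential lam x k = ((gramMatrix lam x k)⁻¹ *ᵥ x k) ⬝ᵥ
      (gramMatrix lam x k *ᵥ ((gramMatrix lam x k)⁻¹ *ᵥ x k)) := by
  rw [gramMatrix_mulVec_inv hlam, dotProduct_comm]
  rfl

lemma potential_nonneg (hlam : 0 < lam) (k : ℕ) : 0 ≤ potential lam x k := by
  rw [potential_eq_quad hlam]
  exact (mul_nonneg hlam.le (dotProduct_self_nonneg' _)).trans (gramMatrix_quad_ge _ k)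

/-- Cauchy–Schwarz for the Gram form, from the discriminant of the nonnegative quadratic `t ↦` form
at `t • u + v`. -/
lemma sq_dotProduct_gramMatrix_le (hlam : 0 < lam) (k : ℕ) (u v : Fin d → ℝ) :
    (u ⬝ᵥ (gramMatrix lam x k *ᵥ v)) ^ 2 ≤
      (u ⬝ᵥ (gramMatrix lam x k *ᵥ u)) * (v ⬝ᵥ (gramMatrix lam x k *ᵥ v)) := by
  have key : ∀ t : ℝ, 0 ≤ (u ⬝ᵥ (gramMatrix lam x k *ᵥ u)) * (t * t)
      + (2 * (u ⬝ᵥ (gramMatrix lam x k *ᵥ v))) * t + v ⬝ᵥ (gramMatrix lam x k *ᵥ v) := by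
    intro t
    have h := (mul_nonneg hlam.le (dotProduct_self_nonneg' (t • u + v))).trans
      (gramMatrix_quad_ge (x := x) (t • u + v) k)
    have hs : v ⬝ᵥ (gramMatrix lam x k *ᵥ u) = u ⬝ᵥ (gramMatrix lam x k *ᵥ v) := by
      rw [dotProduct_gramMatrix_mulVec, dotProduct_gramMatrix_mulVec, dotProduct_comm v u]
      simp only [mul_comm]
    simp only [mulVec_add, mulVec_smul, dotProduct_add, add_dotProduct, smul_dotProduct,
      dotProduct_smul, smul_eq_mul, hs] at h
    linarith
  have := discrim_le_zero key
  rw [discrim] at this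
  linarith

lemma sq_dotProduct_le (u v : Fin d → ℝ) : (u ⬝ᵥ v) ^ 2 ≤ (u ⬝ᵥ u) * (v ⬝ᵥ v) := by
  have h := Finset.sum_mul_sq_le_sq_mul_sq Finset.univ u v
  simpa only [dotProduct, sq] using h

lemma sq_dotProduct_le_potential_mul (hlam : 0 < lam) (k : ℕ) (w : Fin d → ℝ) :
    (x k ⬝ᵥ w) ^ 2 ≤ potential lam x k * (w ⬝ᵥ (gramMatrix lam x k *ᵥ w)) := by
  have h := sq_dotProduct_gramMatrix_le (x := x) hlam k w ((gramMatrix lam x k)⁻¹ *ᵥ x k)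
  rw [← potential_eq_quad hlam, gramMatrix_mulVec_inv hlam, dotProduct_comm w] at h
  linarith

/-- With `y` the inverse Gram matrix applied to `x k`, the potential `p = x k ⬝ᵥ y` satisfies `p² ≤
lam * (y ⬝ᵥ y) ≤ p`. -/
lemma potential_le_one (hlam : 0 < lam) (k : ℕ) (hx : x k ⬝ᵥ x k ≤ lam) :
    potential lam x k ≤ 1 := by
  set y := (gramMatrix lam x k)⁻¹ *ᵥ x k with hy
  have h1 : lam * (y ⬝ᵥ y) ≤ potential lam x k := by
    rw [potential_eq_quad hlam]; exact gramMatrix_quad_ge y k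
  have h2 : potential lam x k ^ 2 ≤ (x k ⬝ᵥ x k) * (y ⬝ᵥ y) := sq_dotProduct_le _ _
  have h3 : potential lam x k ^ 2 ≤ potential lam x k :=
    h2.trans ((mul_le_mul_of_nonneg_right hx (dotProduct_self_nonneg' y)).trans h1)
  nlinarith [potential_nonneg (x := x) hlam k]

/-- Each eigenvalue is the quadratic form at a unit eigenvector, hence at most `lam + n * lam`. -/
lemma det_gramMatrix_le (hlam : 0 < lam) (n : ℕ) (hx : ∀ k < n, x k ⬝ᵥ x k ≤ lam) :
    (gramMatrix lam x n).det ≤ (lam * (1 + n)) ^ d := by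
  have hH := gramMatrix_isHermitian (lam := lam) (x := x) n
  rw [hH.det_eq_prod_eigenvalues]
  have h0 : ∀ i, 0 ≤ hH.eigenvalues i := fun i => ((gramMatrix_posDef hlam n).eigenvalues_pos i).le
  have h1 : ∀ i, hH.eigenvalues i ≤ lam * (1 + n) := by
    intro i
    set v : Fin d → ℝ := (hH.eigenvectorBasis i).ofLp with hv
    have hvv : v ⬝ᵥ v = 1 := by
      have := hH.eigenvectorBasis.orthonormal.1 i
      have h2 := EuclideanSpace.real_norm_sq_eq (hH.eigenvectorBasis i)
      rw [this] at h2
      simp only [dotProduct, hv, ← sq]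
      rw [← h2]; norm_num
    have he : hH.eigenvalues i = v ⬝ᵥ (gramMatrix lam x n *ᵥ v) := by
      rw [hH.eigenvalues_eq]; simp [hv]
    rw [he, dotProduct_gramMatrix_mulVec, hvv, mul_add, mul_one]
    refine add_le_add le_rfl ?_
    calc _ ≤ ∑ _τ ∈ Finset.range n, lam := by
          refine Finset.sum_le_sum fun τ hτ => ?_
          have := sq_dotProduct_le (x τ) v
          rw [hvv, mul_one, sq] at this
          exact this.trans (hx τ (Finset.mem_range.1 hτ))
      _ = _ := by simp [mul_comm]
  calc ∏ i, ((hH.eigenvalues i : ℝ)) ≤ ∏ _i : Fin d, lam * (1 + n) :=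
        Finset.prod_le_prod (fun i _ => h0 i) fun i _ => h1 i
    _ = _ := by simp

lemma le_two_mul_log {a : ℝ} (h0 : 0 ≤ a) (h1 : a ≤ 1) : a ≤ 2 * Real.log (1 + a) := by
  have h := Real.one_sub_inv_le_log_of_pos (x := 1 + a) (by linarith)
  have e : 1 - (1 + a)⁻¹ = a / (1 + a) := by field_simp; ring
  rw [e, div_le_iff₀ (by linarith)] at h
  have hl : 0 ≤ Real.log (1 + a) := Real.log_nonneg (by linarith)
  nlinarith

lemma sum_potential_le (hlam : 0 < lam) (n : ℕ) (hx : ∀ k < n, x k ⬝ᵥ x k ≤ lam) :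
    ∑ k ∈ Finset.range n, potential lam x k ≤ 2 * (d * Real.log (1 + n)) := by
  have htel : ∀ n, ∑ k ∈ Finset.range n, Real.log (1 + potential lam x k) =
      Real.log (gramMatrix lam x n).det - Real.log (gramMatrix lam x 0).det := by
    intro n
    rw [← Finset.sum_range_sub fun k => Real.log (gramMatrix lam x k).det]
    refine Finset.sum_congr rfl fun k _ => ?_
    rw [det_gramMatrix_succ hlam, Real.log_mul (gramMatrix_posDef hlam k).det_pos.ne'
      (by linarith [potential_nonneg (x := x) hlam k])]
    ring
  have h0 : (gramMatrix lam x 0).det = lam ^ d := by simp [gramMatrix]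
  calc _ ≤ ∑ k ∈ Finset.range n, 2 * Real.log (1 + potential lam x k) :=
        Finset.sum_le_sum fun k hk => le_two_mul_log (potential_nonneg hlam k)
          (potential_le_one hlam k (hx k (Finset.mem_range.1 hk)))
    _ = 2 * (Real.log (gramMatrix lam x n).det - Real.log (lam ^ d)) := by
        rw [← Finset.mul_sum, htel, h0]
    _ ≤ 2 * (Real.log ((lam * (1 + n)) ^ d) - Real.log (lam ^ d)) := by
        gcongr
        · exact (gramMatrix_posDef hlam n).det_pos
        · exact det_gramMatrix_le hlam n hx
    _ = _ := by
        have : (0 : ℝ) < 1 + n := by positivity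
        rw [Real.log_pow, Real.log_pow, Real.log_mul hlam.ne' this.ne']
        ring

/-- Elliptical potential bound for a sequence of inner products with controlled past. -/
theorem sum_abs_inner_le (n : ℕ) (x w : ℕ → EuclideanSpace ℝ (Fin d)) {BX BW b : ℝ}
    (hBX : 0 ≤ BX) (hb : 0 ≤ b) (hx : ∀ k < n, ‖x k‖ ≤ BX) (hw : ∀ k < n, ‖w k‖ ≤ BW)
    (hpast : ∀ k < n, ∑ τ ∈ Finset.range k, (inner ℝ (x τ) (w k)) ^ 2 ≤ b) :
    ∑ k ∈ Finset.range n, |inner ℝ (x k) (w k)| ≤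
      Real.sqrt (n * (2 * (d * Real.log (1 + n)) * ((BX * BW) ^ 2 + b))) := by
  have hlog : 0 ≤ Real.log (1 + (n : ℝ)) := Real.log_nonneg (by simp)
  have hsq : 0 ≤ (BX * BW) ^ 2 + b := add_nonneg (sq_nonneg _) hb
  -- The regularizer below is `BX ^ 2`, which must be positive. It keeps every potential at most one
  -- and costs `(BX * BW) ^ 2` in the Gram norm of `w k`.
  rcases hBX.eq_or_lt with h0 | hpos
  · have : ∀ k ∈ Finset.range n, |inner ℝ (x k) (w k)| = 0 := fun k hk => by
      have := hx k (Finset.mem_range.1 hk)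
      rw [← h0] at this
      rw [norm_le_zero_iff.1 this, inner_zero_left, abs_zero]
    rw [Finset.sum_eq_zero this]
    exact Real.sqrt_nonneg _
  · have hin : ∀ u v : EuclideanSpace ℝ (Fin d), inner ℝ u v = u.ofLp ⬝ᵥ v.ofLp := fun u v => by
      rw [EuclideanSpace.inner_eq_star_dotProduct, dotProduct_comm]; simp
    have hnorm : ∀ u : EuclideanSpace ℝ (Fin d), u.ofLp ⬝ᵥ u.ofLp = ‖u‖ ^ 2 := fun u => by
      rw [← hin, real_inner_self_eq_norm_sq]
    have hlam : 0 < BX ^ 2 := by positivity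
    set X : ℕ → Fin d → ℝ := fun k => (x k).ofLp with hX
    have hxl : ∀ k < n, X k ⬝ᵥ X k ≤ BX ^ 2 := fun k hk => by
      rw [hX, hnorm]
      exact pow_le_pow_left₀ (norm_nonneg _) (hx k hk) 2
    have hterm : ∀ k ∈ Finset.range n, (inner ℝ (x k) (w k)) ^ 2 ≤
        potential (BX ^ 2) X k * ((BX * BW) ^ 2 + b) := by
      intro k hk
      have hk' := Finset.mem_range.1 hk
      rw [hin]
      refine (sq_dotProduct_le_potential_mul (x := X) hlam k (w k).ofLp).trans ?_
      refine mul_le_mul_of_nonneg_left ?_ (potential_nonneg hlam k)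
      rw [dotProduct_gramMatrix_mulVec, hnorm, mul_pow]
      refine add_le_add ?_ ?_
      · exact mul_le_mul_of_nonneg_left (pow_le_pow_left₀ (norm_nonneg _) (hw k hk') 2) hlam.le
      · refine le_of_eq_of_le (Finset.sum_congr rfl fun τ _ => ?_) (hpast k hk')
        rw [hin, sq]
    apply Real.le_sqrt_of_sq_le
    calc _ ≤ (n : ℝ) * ∑ k ∈ Finset.range n, |inner ℝ (x k) (w k)| ^ 2 := by
          have := sq_sum_le_card_mul_sum_sq (s := Finset.range n)
            (f := fun k => |inner ℝ (x k) (w k)|)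
          simpa using this
      _ ≤ n * ∑ k ∈ Finset.range n, potential (BX ^ 2) X k * ((BX * BW) ^ 2 + b) := by
          gcongr with k hk
          rw [sq_abs]
          exact hterm k hk
      _ ≤ _ := by
          rw [← Finset.sum_mul]
          gcongr
          exact sum_potential_le hlam n hxl

end EllipticalPotential

/-! ### Bellman errors in a complete class and the transfer coefficient -/

lemma sq_max_sub_le {a q t : ℝ} (h : q ≤ t) : (max a q - t) ^ 2 ≤ (a - t) ^ 2 := by
  rcases le_total q a with h1 | h1
  · rw [max_eq_left h1]
  · rw [max_eq_right h1]
    nlinarith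

lemma sq_integral_le {X : Type*} [MeasurableSpace X] {μ : Measure X} [IsProbabilityMeasure μ]
    {f : X → ℝ} (hf : MemLp f 2 μ) : (∫ x, f x ∂μ) ^ 2 ≤ ∫ x, f x ^ 2 ∂μ := by
  have h := variance_nonneg f μ
  rw [variance_eq_sub hf] at h
  simpa using h

section

variable {S A : Type*} [MeasurableSpace S] [MeasurableSpace A] {H : ℕ} {M : MDP S A}
  {C : FunClass S A H} {πref : Policy S A} {V : ℝ}

/-- Bellman error `f_h - T f_{h+1}`. -/
noncomputable def bellmanErr (M : MDP S A) (q : QTuple S A H) (h : Fin H) (z : S × A) : ℝ :=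
  q h z - M.bellman (q.at (h + 1)) z

lemma IsCompleteClass.isValueFn (hC : IsCompleteClass M C πref V)
    {q : QTuple S A H} (hq : ∀ h, q h ∈ C h)
    (h : Fin H) : IsValueFn V (q h) := by
  have := hC.valueFn q hq h
  rwa [QTuple.at_val] at this

lemma IsCompleteClass.measurable_bellmanErr (hC : IsCompleteClass M C πref V)
    {q : QTuple S A H} (hq : ∀ h, q h ∈ C h)
    (h : Fin H) : Measurable (bellmanErr M q h) :=
  (hC.isValueFn hq h).measurable.sub (M.measurable_bellman (hC.valueFn q hq (h + 1)))

lemma IsCompleteClass.bellmanErr_mem (hC : IsCompleteClass M C πref V)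
    {q : QTuple S A H} (hq : ∀ h, q h ∈ C h)
    (h : Fin H) (z : S × A) :
    bellmanErr M q h z ∈ Set.Icc (-(1 + V)) V := by
  have h1 := (hC.isValueFn hq h).mem_Icc z
  have h2 := M.bellman_mem (hC.valueFn q hq (h + 1)) z
  simp only [bellmanErr, Set.mem_Icc] at *
  constructor <;> linarith

lemma IsCompleteClass.integrable_sq_bellmanErr (hC : IsCompleteClass M C πref V)
    {q : QTuple S A H} (hq : ∀ h, q h ∈ C h)
    (h : Fin H) (μ : Measure (S × A))
    [IsProbabilityMeasure μ] : Integrable (fun z => bellmanErr M q h z ^ 2) μ := by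
  refine integrable_of_mem_Icc ((hC.measurable_bellmanErr hq h).pow_const 2)
    (a := 0) (b := (1 + V) ^ 2) fun z => ⟨sq_nonneg _, ?_⟩
  have := hC.bellmanErr_mem hq h z
  exact sq_le_sq' this.1 (by linarith [this.2])

lemma IsCompleteClass.sq_integral_bellmanErr_le (hC : IsCompleteClass M C πref V)
    {q : QTuple S A H} (hq : ∀ h, q h ∈ C h)
    (h : Fin H) (μ : Measure (S × A))
    [IsProbabilityMeasure μ] :
    (∫ z, bellmanErr M q h z ∂μ) ^ 2 ≤ ∫ z, bellmanErr M q h z ^ 2 ∂μ :=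
  sq_integral_le ((memLp_two_iff_integrable_sq
    (hC.measurable_bellmanErr hq h).aestronglyMeasurable).2 (hC.integrable_sq_bellmanErr hq h μ))

lemma IsCompleteClass.value_sub_le (hC : IsCompleteClass M C πref V)
    {q : QTuple S A H} (hq : ∀ h, q h ∈ C h)
    (πe : Policy S A) :
    M.value H πe - ∫ s, supAct (q.at 0) s ∂M.ρ ≤
      ∑ h : Fin H, ∫ z, (M.bellman (q.at (h + 1)) z - q h z) ∂(M.occ πe h) := by
  have h1 := M.value_sub_le_sum (π := πe) (f := q.at) (hC.valueFn q hq) q.at_self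
  rw [Finset.sum_range] at h1
  simpa only [QTuple.at_val] using h1

lemma IsCompleteClass.sub_value_greedy_eq (hC : IsCompleteClass M C πref V)
    {q : QTuple S A H} (hq : ∀ h, q h ∈ C h)
    (g : ArgmaxRule C) :
    ∫ s, supAct (q.at 0) s ∂M.ρ - M.value H (g.greedy q) =
      ∑ h : Fin H, ∫ z, bellmanErr M q h z ∂(M.occ (g.greedy q) h) := by
  have h1 := M.sub_value_eq_sum (π := g.greedy q) (f := q.at) (hC.valueFn q hq) q.at_self
    (σ := fun h => g.sel (q.at h)) (fun h => g.measurable_sel _)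
    (fun h hh s a => g.isMax ⟨h, hh⟩ _ (by simpa [QTuple.at, hh] using hq ⟨h, hh⟩) s a)
    (fun h => rfl)
  rw [Finset.sum_range] at h1
  simpa only [QTuple.at_val, bellmanErr] using h1

lemma IsCompleteClass.Q_le_bellman (hC : IsCompleteClass M C πref V)
    {q : QTuple S A H} (hq : ∀ h, q h ∈ C h)
    (hQ : ∀ h : Fin H, M.Q H πref h ∈ C h)
    (hle : ∀ (h : Fin H) z, M.Q H πref h z ≤ q h z) (h : Fin H) (z : S × A) :
    M.Q H πref h z ≤ M.bellman (q.at (h + 1)) z := by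
  rcases Nat.lt_or_ge (h + 1) H with hh | hh
  · refine M.Q_le_bellman h.2 (hC.valueFn q hq (h + 1))
      (hC.isValueFn hQ ⟨h + 1, hh⟩).measurable (fun w => ?_) z
    simpa [QTuple.at, hh] using hle ⟨h + 1, hh⟩ w
  · have h0 : M.Q H πref (h + 1) = 0 := funext fun w => M.Q_of_le πref hh w
    refine M.Q_le_bellman h.2 (hC.valueFn q hq (h + 1)) (by rw [h0]; exact measurable_zero)
      (fun w => ?_) z
    rw [h0]
    exact ((hC.valueFn q hq (h + 1)).mem_Icc w).1

lemma sum_le_transferCoeff_mul {ν : Fin H → Measure (S × A)} {πe : Policy S A} {c : ℝ}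
    (hc : 0 ≤ c) (hcoef : transferCoeff M C πref ν πe = ENNReal.ofReal c) {q : QTuple S A H}
    (hq : q ∈ calibrated M C πref) :
    ∑ h : Fin H, ∫ z, (M.bellman (q.at (h + 1)) z - q h z) ∂(M.occ πe h) ≤
      c * Real.sqrt (∑ h : Fin H, ∫ z, bellmanErr M q h z ^ 2 ∂(ν h)) := by
  have h1 : ENNReal.ofReal (∑ h : Fin H, ∫ z, (M.bellman (q.at (h + 1)) z - q h z) ∂(M.occ πe h)) /
      ENNReal.ofReal (Real.sqrt
        (∑ h : Fin H, ∫ z, (M.bellman (q.at (h + 1)) z - q h z) ^ 2 ∂(ν h)))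
      ≤ ENNReal.ofReal c := by
    rw [← hcoef]
    exact le_max_of_le_right (le_iSup₂_of_le q hq le_rfl)
  have hone : ENNReal.ofReal c ≠ 0 := by
    rw [← hcoef]
    exact (lt_of_lt_of_le one_pos (le_max_left _ _)).ne'
  have e : ∑ h : Fin H, ∫ z, (M.bellman (q.at (h + 1)) z - q h z) ^ 2 ∂(ν h) =
      ∑ h : Fin H, ∫ z, bellmanErr M q h z ^ 2 ∂(ν h) := by
    refine Finset.sum_congr rfl fun h _ => integral_congr_ae (ae_of_all _ fun z => ?_)
    simp only [bellmanErr]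
    ring
  -- The denominator may vanish: as the coefficient is finite and nonzero, the quotient can be
  -- cleared anyway, a zero denominator forcing a zero truncated numerator.
  rw [ENNReal.div_le_iff_le_mul (Or.inr ENNReal.ofReal_ne_top) (Or.inr hone),
    ← ENNReal.ofReal_mul hc, e] at h1
  exact (ENNReal.ofReal_le_ofReal_iff (mul_nonneg hc (Real.sqrt_nonneg _))).1 h1

lemma one_le_of_transferCoeff_eq {ν : Fin H → Measure (S × A)} {πe : Policy S A} {c : ℝ}
    (hcoef : transferCoeff M C πref ν πe = ENNReal.ofReal c) : 1 ≤ c := by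
  rw [← ENNReal.one_le_ofReal, ← hcoef]
  exact le_max_left _ _

/-- A class which is pessimistic with respect to some policy is complete. -/
lemma IsPessimistic.isCompleteClass {πe : Policy S A} (hπe : IsPessimistic M C πe)
    (g : ArgmaxRule C) (hV : 0 ≤ V)
    (hC : ∀ h, ∀ f ∈ C h, Measurable f ∧ ∀ z, f z ∈ Set.Icc 0 V)
    (hmax : ∀ h : Fin H, ∀ f ∈ C h, (fun z => max (f z) (M.Q H πref h z)) ∈ C h) :
    IsCompleteClass M C πref V where
  valueFn q hq k := by
    unfold QTuple.at
    split_ifs with hk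
    · exact ⟨(hC _ _ (hq _)).1, (hC _ _ (hq _)).2, g.sel _, g.measurable_sel _,
        g.isMax _ _ (hq _)⟩
    · exact ⟨measurable_zero, fun z => ⟨le_rfl, hV⟩, g.sel 0, g.measurable_sel _, fun s a => le_rfl⟩
  bellman_mem q hq h := by
    rcases Nat.lt_or_ge (h + 1) H with hh | hh
    · have := hπe.complete h hh (q ⟨h + 1, hh⟩) (hq _)
      simpa [QTuple.at, hh] using this
    -- At the last stage the backup of `0` is the mean reward, which is `Q^{πe}` there;
    -- realizability replaces completeness.
    · have e : M.bellman (q.at (h + 1)) = M.Q H πe h := by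
        funext z
        rw [M.Q_eq_of_lt πe h.2, funext (M.Q_of_le πe hh)]
        simp [QTuple.at, Nat.not_lt.2 hh, M.bellman_zero]
      rw [e]
      exact hπe.realizable h
  max_mem := hmax

lemma value_le_of_Q_mem {πe : Policy S A} (hm : Measurable (M.Q H πe 0))
    (hQ : ∀ z, M.Q H πe 0 z ∈ Set.Icc 0 V) : M.value H πe ≤ V := by
  rw [M.value_eq_integral_Q]
  exact (integral_mem_Icc (integrable_of_mem_Icc hm hQ) (ae_of_all _ hQ)).2

/-! ### Error control and value gaps of the iterates -/

section Run

variable {Ω : Type*} {mΩ : MeasurableSpace Ω} {Pr : Measure Ω} {K : ℕ} {g : ArgmaxRule C}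
  {ν : Fin H → Measure (S × A)}

lemma Run.iter_calibrated (r : Run Pr K M C g πref ν) (hC : IsCompleteClass M C πref V) {k : ℕ}
    (hk : k < K) (ω : Ω) : r.iter (k + 1) ω ∈ calibrated M C πref := fun h =>
  ⟨r.iter_succ_mem hC hk ω h, fun _ => le_max_right _ _⟩

/-- Clipping at `Q^ref` does not increase the Bellman error. -/
lemma Run.sq_bellmanErr_iter_le (r : Run Pr K M C g πref ν) (hC : IsCompleteClass M C πref V)
    (hQ : ∀ h : Fin H, M.Q H πref h ∈ C h) {k : ℕ} (hk : k < K) (ω : Ω) (h : Fin H) (z : S × A) :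
    bellmanErr M (r.iter (k + 1) ω) h z ^ 2 ≤
      (r.fhat k ω h z - M.bellman ((r.iter (k + 1) ω).at (h + 1)) z) ^ 2 :=
  -- The next-stage iterate dominates `Q^ref`, hence so does its backup; taking the maximum with
  -- `Q^ref` can then only approach that backup.
  sq_max_sub_le (hC.Q_le_bellman (r.iter_succ_mem hC hk ω) hQ
    (fun h => (r.iter_calibrated hC hk ω h).2) h z)

/-- The Bellman errors of all iterates are at most `b` on the data available to them. -/
def Run.HasSmallErrors (r : Run Pr K M C g πref ν) (b : ℝ) (ω : Ω) : Prop :=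
  ∀ h : Fin H, ∀ k < K, K * ∫ z, bellmanErr M (r.iter (k + 1) ω) h z ^ 2 ∂(ν h)
    + ∑ τ ∈ Finset.range (k + 1), ∫ z, bellmanErr M (r.iter (k + 1) ω) h z ^ 2
        ∂(M.occ (g.greedy (r.iter τ ω)) h) ≤ b

lemma Run.exists_hasSmallErrors [IsProbabilityMeasure Pr] [∀ h, IsProbabilityMeasure (ν h)]
    (r : Run Pr K M C g πref ν) (hC : IsCompleteClass M C πref V)
    (hQ : ∀ h : Fin H, M.Q H πref h ∈ C h) (hV : 0 ≤ V)
    (hH : 0 < H) (hK : 0 < K) (hsize : 0 < C.size) {δ : ℝ} (hδ : 0 < δ) :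
    ∃ G : Set Ω, MeasurableSet G ∧ 1 - δ ≤ Pr.real G ∧ ∀ ω ∈ G,
      r.HasSmallErrors (16 * (1 + V) ^ 2 * Real.log (H * K * C.size / δ)) ω := by
  obtain ⟨G, hG, hGδ, hGb⟩ := r.exists_good_event hC hV hH hK hsize hδ
  refine ⟨G, hG, hGδ, fun ω hω h k hk => le_trans ?_ (hGb ω hω h k hk)⟩
  have hmono : ∀ μ : Measure (S × A), IsProbabilityMeasure μ →
      ∫ z, bellmanErr M (r.iter (k + 1) ω) h z ^ 2 ∂μ ≤
        ∫ z, (r.fhat k ω h z - M.bellman ((r.iter (k + 1) ω).at (h + 1)) z) ^ 2 ∂μ := by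
    intro μ _
    have hit := r.iter_succ_mem hC hk ω
    have hvf := hC.valueFn _ hit (h + 1)
    have hvq : IsValueFn V (r.fhat k ω h) := hC.isValueFn (fun h => r.fhat_mem k hk h ω) h
    refine integral_mono (hC.integrable_sq_bellmanErr hit h μ) ?_
      (r.sq_bellmanErr_iter_le hC hQ hk ω h)
    refine integrable_of_mem_Icc ((hvq.measurable.sub (M.measurable_bellman hvf)).pow_const 2)
      (a := 0) (b := (1 + V) ^ 2) fun z => ⟨sq_nonneg _, ?_⟩
    have h1 := hvq.mem_Icc z
    have h2 := M.bellman_mem hvf z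
    exact sq_le_sq' (by linarith [h1.1, h2.2]) (by linarith [h1.2, h2.1])
  exact add_le_add (mul_le_mul_of_nonneg_left (hmono _ inferInstance) (Nat.cast_nonneg _))
    (Finset.sum_le_sum fun τ _ => hmono _ inferInstance)

/-- Cumulative gap between the estimated and the true values of the greedy policies. -/
lemma Run.sum_sub_value_le (r : Run Pr K M C g πref ν) (hC : IsCompleteClass M C πref V)
    {b : ℝ} (hb : 0 ≤ b) {ω : Ω} (hω : r.HasSmallErrors b ω) {n : ℕ} (hn : n ≤ K)
    {G : Set (QTuple S A H)} (hG : calibrated M C πref ⊆ G) {d : ℕ} {BX BW : ℝ} (hBX : 0 ≤ BX)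
    (hbil : IsBilinear M g G d BX BW) :
    ∑ k ∈ Finset.range n, (∫ s, supAct ((r.iter (k + 1) ω).at 0) s ∂M.ρ
        - M.value H (r.policy (k + 1) ω)) ≤
      H * Real.sqrt (n * (2 * (d * Real.log (1 + n)) * ((BX * BW) ^ 2 + b))) := by
  have hmem : ∀ k < n, ∀ h, r.iter (k + 1) ω h ∈ C h := fun k hk =>
    r.iter_succ_mem hC (hk.trans_le hn) ω
  have hmemG : ∀ k < n, r.iter (k + 1) ω ∈ G := fun k hk =>
    hG (r.iter_calibrated hC (hk.trans_le hn) ω)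
  have hstage : ∀ h : Fin H, ∑ k ∈ Finset.range n,
      ∫ z, bellmanErr M (r.iter (k + 1) ω) h z ∂(M.occ (g.greedy (r.iter (k + 1) ω)) h) ≤
      Real.sqrt (n * (2 * (d * Real.log (1 + n)) * ((BX * BW) ^ 2 + b))) := by
    intro h
    obtain ⟨X, W, hX, hW, hXW⟩ := hbil h
    have hXW' : ∀ τ < n, ∀ k < n,
        |∫ z, bellmanErr M (r.iter (k + 1) ω) h z ∂(M.occ (g.greedy (r.iter (τ + 1) ω)) h)| =
          |inner ℝ (X (r.iter (τ + 1) ω)) (W (r.iter (k + 1) ω))| := fun τ hτ k hk =>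
      hXW _ (hmemG τ hτ) _ (hmemG k hk)
    refine le_trans (Finset.sum_le_sum fun k hk => ?_)
      (sum_abs_inner_le n (fun k => X (r.iter (k + 1) ω)) (fun k => W (r.iter (k + 1) ω)) hBX hb
        (fun k hk => hX _ (hmemG k hk)) (fun k hk => hW _ (hmemG k hk)) fun k hk => ?_)
    · have hk' := Finset.mem_range.1 hk
      rw [← hXW' k hk' k hk']
      exact le_abs_self _
    · have h1 := hω h k (hk.trans_le hn)
      -- The first iterate `0` need not lie in `G`, so the bilinear factorization may fail for it.
      -- Its term and the offline term are nonnegative and are discarded.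
      rw [Finset.sum_range_succ'] at h1
      have h2 : 0 ≤ ∫ z, bellmanErr M (r.iter (k + 1) ω) h z ^ 2
          ∂(M.occ (g.greedy (r.iter 0 ω)) h) := integral_nonneg fun z => sq_nonneg _
      have h3 : 0 ≤ K * ∫ z, bellmanErr M (r.iter (k + 1) ω) h z ^ 2 ∂(ν h) :=
        mul_nonneg (Nat.cast_nonneg _) (integral_nonneg fun z => sq_nonneg _)
      refine le_trans (Finset.sum_le_sum fun τ hτ => ?_) (by linarith :
        ∑ τ ∈ Finset.range k, ∫ z, bellmanErr M (r.iter (k + 1) ω) h z ^ 2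
          ∂(M.occ (g.greedy (r.iter (τ + 1) ω)) h) ≤ b)
      have hτ' := (Finset.mem_range.1 hτ).trans hk
      rw [← sq_abs, ← hXW' τ hτ' k hk, sq_abs]
      exact hC.sq_integral_bellmanErr_le (hmem k hk) h _
  calc _ = ∑ k ∈ Finset.range n, ∑ h : Fin H, ∫ z, bellmanErr M (r.iter (k + 1) ω) h z
        ∂(M.occ (g.greedy (r.iter (k + 1) ω)) h) :=
        Finset.sum_congr rfl fun k hk =>
          hC.sub_value_greedy_eq (hmem k (Finset.mem_range.1 hk)) g
    _ = ∑ h : Fin H, ∑ k ∈ Finset.range n, ∫ z, bellmanErr M (r.iter (k + 1) ω) h z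
        ∂(M.occ (g.greedy (r.iter (k + 1) ω)) h) := Finset.sum_comm
    _ ≤ ∑ _h : Fin H, Real.sqrt (n * (2 * (d * Real.log (1 + n)) * ((BX * BW) ^ 2 + b))) :=
        Finset.sum_le_sum fun h _ => hstage h
    _ = _ := by simp

/-- Gap between the value of the comparator and the estimated value of an iterate. -/
lemma Run.value_sub_le (r : Run Pr K M C g πref ν) (hC : IsCompleteClass M C πref V)
    {b : ℝ} {ω : Ω} (hω : r.HasSmallErrors b ω) {k : ℕ} (hk : k < K) {πe : Policy S A} {c : ℝ}
    (hc : 0 ≤ c) (hcoef : transferCoeff M C πref ν πe = ENNReal.ofReal c) :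
    M.value H πe - ∫ s, supAct ((r.iter (k + 1) ω).at 0) s ∂M.ρ ≤ c * Real.sqrt (H * (b / K)) := by
  have hK : (0 : ℝ) < K := by exact_mod_cast (Nat.zero_le k).trans_lt hk
  refine (hC.value_sub_le (r.iter_succ_mem hC hk ω) πe).trans
    ((sum_le_transferCoeff_mul hc hcoef (r.iter_calibrated hC hk ω)).trans ?_)
  gcongr
  calc _ ≤ ∑ _h : Fin H, b / K := by
        refine Finset.sum_le_sum fun h _ => ?_
        -- Only the offline part of the error control is kept here.
        rw [le_div_iff₀' hK]
        refine le_trans (le_add_of_nonneg_right ?_) (hω h k hk)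
        exact Finset.sum_nonneg fun τ _ => integral_nonneg fun z => sq_nonneg _
    _ = _ := by simp

/-- Calibration in action: an iterate above `Q^ref` cannot estimate the initial value below `V^ref`.
-/
lemma Run.refValue_le (r : Run Pr K M C g πref ν) (hC : IsCompleteClass M C πref V)
    (hQ : ∀ h : Fin H, M.Q H πref h ∈ C h) (hH : 0 < H) {k : ℕ} (hk : k < K) (ω : Ω) :
    M.refValue H πref ≤ ∫ s, supAct ((r.iter (k + 1) ω).at 0) s ∂M.ρ := by
  have h1 : IsValueFn V (M.Q H πref 0) := hC.isValueFn hQ ⟨0, hH⟩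
  have h2 := hC.valueFn _ (r.iter_succ_mem hC hk ω) 0
  have hle : ∀ z, M.Q H πref 0 z ≤ (r.iter (k + 1) ω).at 0 z := fun z => by
    simpa [QTuple.at, hH] using (r.iter_calibrated hC hk ω ⟨0, hH⟩).2 z
  refine integral_mono (f := supAct (M.Q H πref 0)) (μ := M.ρ)
    (integrable_of_mem_Icc h1.measurable_supAct h1.supAct_mem)
    (integrable_of_mem_Icc h2.measurable_supAct h2.supAct_mem) fun s => ?_
  obtain ⟨σ, _, hσ⟩ := h1.exists_sel
  rw [supAct_eq_of_isMax hσ]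
  exact (hle _).trans (h2.le_supAct _)

lemma refValue_le_of_isCompleteClass (hC : IsCompleteClass M C πref V)
    (hQ : ∀ h : Fin H, M.Q H πref h ∈ C h) (hH : 0 < H) : M.refValue H πref ≤ V := by
  have h1 : IsValueFn V (M.Q H πref 0) := hC.isValueFn hQ ⟨0, hH⟩
  exact (integral_mem_Icc (f := supAct (M.Q H πref 0)) (μ := M.ρ)
    (integrable_of_mem_Icc h1.measurable_supAct h1.supAct_mem) (ae_of_all _ h1.supAct_mem)).2

end Run

end

/-! ### Comparison of the explicit bounds with `rate` -/

section Rate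

variable {H K d N : ℕ} {δ : ℝ}

lemma half_le_log {x : ℝ} (hx : 2 ≤ x) : 1 / 2 ≤ Real.log x := by
  have h1 := Real.log_le_log two_pos hx
  have h2 := Real.log_two_gt_d9
  linarith

lemma half_le_log_one_add (hK : 0 < K) : 1 / 2 ≤ Real.log (1 + (K : ℝ)) := by
  have : (1 : ℝ) ≤ K := by exact_mod_cast hK
  exact half_le_log (by linarith)

lemma one_le_mul_div (hH : 0 < H) (hK : 0 < K) (hN : 0 < N) (hδ : 0 < δ) (hδ1 : δ < 1) :
    1 ≤ (H * K * N / δ : ℝ) := by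
  rw [le_div_iff₀ hδ, one_mul]
  have : (1 : ℝ) ≤ H * K * N := by exact_mod_cast Nat.mul_pos (Nat.mul_pos hH hK) hN
  linarith

/-- The factor 2 inside the logarithm keeps it away from zero even for `H = K = N = 1`, which lets
constants be absorbed into the rate. -/
lemma half_le_log_card (hH : 0 < H) (hK : 0 < K) (hN : 0 < N) (hδ : 0 < δ) (hδ1 : δ < 1) :
    1 / 2 ≤ Real.log (2 * H * K * N / δ) := by
  have h := one_le_mul_div hH hK hN hδ hδ1
  have e : (2 * H * K * N / δ : ℝ) = 2 * (H * K * N / δ) := by ring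
  exact half_le_log (by rw [e]; linarith)

lemma log_card_le {N' : ℕ} (hH : 0 < H) (hK : 0 < K) (hN' : 0 < N') (hN : N' ≤ N) (hδ : 0 < δ)
    (hδ1 : δ < 1) : Real.log (H * K * N' / δ) ≤ Real.log (2 * H * K * N / δ) := by
  have h := one_le_mul_div hH hK hN' hδ hδ1
  have hN0 : (N' : ℝ) ≤ N := by exact_mod_cast hN
  refine Real.log_le_log (by linarith) ?_
  have h1 : (H * K * N' / δ : ℝ) ≤ H * K * N / δ := by gcongr
  have e : (2 * H * K * N / δ : ℝ) = 2 * (H * K * N / δ) := by ring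
  rw [e]
  linarith

lemma rate_nonneg : 0 ≤ rate H K d N δ := mul_nonneg (Nat.cast_nonneg _) (Real.sqrt_nonneg _)

lemma sq_rate (hH : 0 < H) (hK : 0 < K) (hN : 0 < N) (hδ : 0 < δ) (hδ1 : δ < 1) :
    rate H K d N δ ^ 2 =
      H ^ 2 * (d * K * Real.log (2 * H * K * N / δ) * Real.log (1 + K)) := by
  have h1 := half_le_log_card hH hK hN hδ hδ1
  have h2 := half_le_log_one_add hK
  rw [rate, mul_pow, Real.sq_sqrt]
  exact mul_nonneg (mul_nonneg (by positivity) (by linarith)) (by linarith)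

lemma half_le_rate (hH : 0 < H) (hK : 0 < K) (hd : 0 < d) (hN : 0 < N) (hδ : 0 < δ)
    (hδ1 : δ < 1) : 1 / 2 ≤ rate H K d N δ := by
  refine (le_abs_self _).trans (abs_le_of_sq_le_sq ?_ rate_nonneg)
  rw [sq_rate hH hK hN hδ hδ1]
  have h1 := half_le_log_card hH hK hN hδ hδ1
  have h2 := half_le_log_one_add hK
  have h3 : (1 : ℝ) ≤ (H : ℝ) ^ 2 * (d * K) := by
    exact_mod_cast Nat.mul_pos (pow_pos hH 2) (Nat.mul_pos hd hK)
  calc (1 / 2 : ℝ) ^ 2 = 1 * (1 / 2 * (1 / 2)) := by norm_num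
    _ ≤ (H : ℝ) ^ 2 * (d * K) * (Real.log (2 * H * K * N / δ) * Real.log (1 + K)) := by gcongr
    _ = _ := by ring

lemma sqrt_potential_le_rate {N' n : ℕ} (hH : 0 < H) (hK : 0 < K) (hn : n ≤ K) (hN' : 0 < N')
    (hN : N' ≤ N) (hδ : 0 < δ) (hδ1 : δ < 1) {V p : ℝ} (hV : 0 ≤ V) (hp : 0 ≤ p) :
    H * Real.sqrt (n * (2 * (d * Real.log (1 + n)) *
        (p ^ 2 + 16 * (1 + V) ^ 2 * Real.log (H * K * N' / δ)))) ≤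
      6 * (1 + V + p) * rate H K d N δ := by
  have h1 := half_le_log_card hH hK (hN'.trans_le hN) hδ hδ1
  have h2 := half_le_log_one_add hK
  have h3 := log_card_le hH hK hN' hN hδ hδ1
  have h4 : 0 ≤ Real.log (H * K * N' / δ) := Real.log_nonneg (one_le_mul_div hH hK hN' hδ hδ1)
  have hnK : (n : ℝ) ≤ K := by exact_mod_cast hn
  have h5 : Real.log (1 + (n : ℝ)) ≤ Real.log (1 + K) :=
    Real.log_le_log (by positivity) (by linarith)
  have h6 : 0 ≤ Real.log (1 + (n : ℝ)) := Real.log_nonneg (by simp)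
  rw [rate]
  set ι := Real.log (2 * H * K * N / δ)
  set ι' := Real.log (H * K * N' / δ)
  set ℓ := Real.log (1 + (K : ℝ))
  have key : Real.sqrt (n * (2 * (d * Real.log (1 + n)) * (p ^ 2 + 16 * (1 + V) ^ 2 * ι'))) ≤
      6 * (1 + V + p) * Real.sqrt (d * K * ι * ℓ) := by
    have hY : 0 ≤ d * K * ι * ℓ :=
      mul_nonneg (mul_nonneg (by positivity) (by linarith)) (by linarith)
    refine Real.sqrt_le_iff.2 ⟨by positivity, ?_⟩
    rw [mul_pow, Real.sq_sqrt hY]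
    have hpι : p ^ 2 ≤ p ^ 2 * (2 * ι) := le_mul_of_one_le_right (sq_nonneg _) (by linarith)
    calc _ ≤ (K : ℝ) * (2 * (d * ℓ) * (p ^ 2 * (2 * ι) + 16 * (1 + V) ^ 2 * ι)) := by gcongr
      _ = (4 * p ^ 2 + 32 * (1 + V) ^ 2) * (d * K * ι * ℓ) := by ring
      -- Both 4 and 32 are at most `36 = 6 ^ 2`.
      _ ≤ _ := by
        refine mul_le_mul_of_nonneg_right ?_ hY
        nlinarith [mul_nonneg hV hp]
  calc _ ≤ (H : ℝ) * (6 * (1 + V + p) * Real.sqrt (d * K * ι * ℓ)) :=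
        mul_le_mul_of_nonneg_left key (Nat.cast_nonneg _)
    _ = _ := by ring

lemma mul_sqrt_le_rate {N' : ℕ} (hH : 0 < H) (hK : 0 < K) (hd : 0 < d) (hN' : 0 < N')
    (hN : N' ≤ N) (hδ : 0 < δ) (hδ1 : δ < 1) {V : ℝ} (hV : 0 ≤ V) :
    K * Real.sqrt (H * (16 * (1 + V) ^ 2 * Real.log (H * K * N' / δ) / K)) ≤
      8 * (1 + V) * rate H K d N δ := by
  have h2 := half_le_log_one_add hK
  have h3 := log_card_le hH hK hN' hN hδ hδ1
  have h4 : 0 ≤ Real.log (H * K * N' / δ) := Real.log_nonneg (one_le_mul_div hH hK hN' hδ hδ1)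
  have hK' : (0 : ℝ) < K := by exact_mod_cast hK
  have hHd : (H : ℝ) ≤ (H : ℝ) ^ 2 * d := by
    have : H * 1 ≤ H * (H * d) := Nat.mul_le_mul_left _ (Nat.mul_pos hH hd)
    have h : ((H * 1 : ℕ) : ℝ) ≤ (H * (H * d) : ℕ) := by exact_mod_cast this
    push_cast at h
    linarith
  refine (le_abs_self _).trans
    (abs_le_of_sq_le_sq ?_ (mul_nonneg (by positivity) rate_nonneg))
  rw [mul_pow, Real.sq_sqrt (by positivity), mul_pow, sq_rate hH hK (hN'.trans_le hN) hδ hδ1]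
  -- The factor `1 / 2` is split off to be replaced by `log (1 + K)`; the later doubling of 32 only
  -- completes the square `8 ^ 2`.
  calc _ = 32 * (1 + V) ^ 2 * K * (H * Real.log (H * K * N' / δ) * (1 / 2)) := by
        field_simp
        ring
    _ ≤ 32 * (1 + V) ^ 2 * K * ((H : ℝ) ^ 2 * d * Real.log (2 * H * K * N / δ)
          * Real.log (1 + K)) := by
        have h5 : 0 ≤ Real.log (2 * H * K * N / δ) := h4.trans h3
        gcongr
    _ ≤ 2 * (32 * (1 + V) ^ 2 * K * ((H : ℝ) ^ 2 * d * Real.log (2 * H * K * N / δ)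
          * Real.log (1 + K))) := by
        have h5 : 0 ≤ Real.log (2 * H * K * N / δ) := h4.trans h3
        have h6 : 0 ≤ Real.log (1 + (K : ℝ)) := by linarith
        have : 0 ≤ 32 * (1 + V) ^ 2 * K * ((H : ℝ) ^ 2 * d * Real.log (2 * H * K * N / δ)
          * Real.log (1 + K)) := by positivity
        linarith
    _ = _ := by ring

end Rate

lemma FunClass.size_mono {S A : Type*} {H : ℕ} {C F : FunClass S A H} (h : ∀ k, C k ⊆ F k) :
    C.size ≤ F.size :=
  Finset.prod_le_prod' fun k _ => Finset.card_le_card (h k)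

lemma FunClass.size_pos {S A : Type*} {H : ℕ} {C : FunClass S A H} {q : QTuple S A H}
    (hq : ∀ k, q k ∈ C k) : 0 < C.size :=
  Finset.prod_pos fun k _ => Finset.card_pos.2 ⟨q k, hq k⟩

/-! ### Regret on the good event -/

section

variable {S A Ω : Type*} [MeasurableSpace S] [MeasurableSpace A] {mΩ : MeasurableSpace Ω}
  {Pr : Measure Ω} {H K : ℕ} {M : MDP S A} {C : FunClass S A H}
  {g : ArgmaxRule C} {πref : Policy S A} {ν : Fin H → Measure (S × A)} {V b : ℝ} {ω : Ω}
  {πe : Policy S A}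

lemma IsPessimistic.value_le (hπe : IsPessimistic M C πe) (hH : 0 < H)
    (hC : ∀ h, ∀ f ∈ C h, Measurable f ∧ ∀ z, f z ∈ Set.Icc 0 V) : M.value H πe ≤ V :=
  value_le_of_Q_mem (hC _ _ (hπe.realizable ⟨0, hH⟩)).1 (hC _ _ (hπe.realizable ⟨0, hH⟩)).2

/-- With `K + 1` rounds, the `K` rounds after the first split at the estimated value of the iterate.
Round zero costs at most `V`, since values are nonnegative. -/
lemma Run.regret_le_of_transferCoeff (r : Run Pr (K + 1) M C g πref ν)
    (hC : IsCompleteClass M C πref V) (hω : r.HasSmallErrors b ω) (hV : M.value H πe ≤ V) {c P : ℝ}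
    (hc : 0 ≤ c) (hcoef : transferCoeff M C πref ν πe = ENNReal.ofReal c)
    (hP : ∑ k ∈ Finset.range K, (∫ s, supAct ((r.iter (k + 1) ω).at 0) s ∂M.ρ
        - M.value H (r.policy (k + 1) ω)) ≤ P) :
    r.regret πe ω ≤ c * ((K + 1 : ℕ) * Real.sqrt (H * (b / (K + 1 : ℕ)))) + P + V := by
  have h0 : M.value H πe - M.value H (r.policy 0 ω) ≤ V := by
    linarith [M.value_nonneg (r.policy 0 ω) H]
  have h1 : ∑ k ∈ Finset.range K, (M.value H πe - ∫ s, supAct ((r.iter (k + 1) ω).at 0) s ∂M.ρ) ≤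
      c * ((K + 1 : ℕ) * Real.sqrt (H * (b / (K + 1 : ℕ)))) := by
    calc _ ≤ ∑ _k ∈ Finset.range K, c * Real.sqrt (H * (b / (K + 1 : ℕ))) :=
          Finset.sum_le_sum fun k hk => r.value_sub_le hC hω
            ((Finset.mem_range.1 hk).trans (Nat.lt_succ_self K)) hc hcoef
      _ = K * (c * Real.sqrt (H * (b / (K + 1 : ℕ)))) := by simp
      _ ≤ (K + 1 : ℕ) * (c * Real.sqrt (H * (b / (K + 1 : ℕ)))) := by
          gcongr
          exact Nat.le_succ K
      _ = _ := by ring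
  have h2 := add_le_add h1 hP
  rw [← Finset.sum_add_distrib] at h2
  simp only [sub_add_sub_cancel] at h2
  rw [Run.regret, Finset.sum_range_succ']
  linarith

lemma Run.regret_le_of_refValue (r : Run Pr (K + 1) M C g πref ν)
    (hC : IsCompleteClass M C πref V) (hQ : ∀ h : Fin H, M.Q H πref h ∈ C h) (hH : 0 < H) {P : ℝ}
    (hP : ∑ k ∈ Finset.range K, (∫ s, supAct ((r.iter (k + 1) ω).at 0) s ∂M.ρ
        - M.value H (r.policy (k + 1) ω)) ≤ P) :
    r.regret πe ω ≤ (K + 1 : ℕ) * (M.value H πe - M.refValue H πref) + P + V := by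
  have h0 := M.value_nonneg (r.policy 0 ω) H
  have h0' := refValue_le_of_isCompleteClass hC hQ hH
  have h1 : ∑ k ∈ Finset.range K, (M.value H πe - ∫ s, supAct ((r.iter (k + 1) ω).at 0) s ∂M.ρ) ≤
      K * (M.value H πe - M.refValue H πref) := by
    calc _ ≤ ∑ _k ∈ Finset.range K, (M.value H πe - M.refValue H πref) :=
          Finset.sum_le_sum fun k hk => sub_le_sub_left (r.refValue_le hC hQ hH
            ((Finset.mem_range.1 hk).trans (Nat.lt_succ_self K)) ω) _
      _ = _ := by rw [Finset.sum_const, Finset.card_range, nsmul_eq_mul]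
  have h2 := add_le_add h1 hP
  rw [← Finset.sum_add_distrib] at h2
  simp only [sub_add_sub_cancel] at h2
  rw [Run.regret, Finset.sum_range_succ']
  push_cast
  linarith

end

end CalQL

/-! ### Assembly -/

theorem mainTheorem1 :
    ∃ c : ℝ, 0 < c ∧
      ∀ {S A Ω : Type*} [MeasurableSpace S] [MeasurableSpace A] [MeasurableSpace Ω]
        (Pr : Measure Ω) [IsProbabilityMeasure Pr]
        (H K d dref : ℕ) (δ Vmax BX BW : ℝ)
        (M : CalQL.MDP S A) (F C : CalQL.FunClass S A H) (g : CalQL.ArgmaxRule C)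
        (πref : CalQL.Policy S A)
        (ν : Fin H → Measure (S × A)) [∀ h, IsProbabilityMeasure (ν h)]
        (run : CalQL.Run Pr K M C g πref ν),
        0 < H → 0 < K → 0 < d → 0 < dref → 0 < δ → δ < 1 →
        (∀ h, C h ⊆ F h) →
        (∀ h, ∀ f ∈ C h, Measurable f ∧ ∀ z, f z ∈ Set.Icc 0 Vmax) →
        (∀ h : Fin H, M.Q H πref h ∈ C h) →
        (∀ h : Fin H, ∀ f ∈ C h, (fun z => max (f z) (M.Q H πref h z)) ∈ C h) →
        CalQL.IsBilinear M g {f | ∀ h, f h ∈ C h} d BX BW →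
        CalQL.IsBilinear M g (CalQL.calibrated M C πref) dref BX BW →
        1 - δ ≤ Pr.real {ω | ∀ πe : CalQL.Policy S A, CalQL.IsPessimistic M C πe →
          ((run.regret πe ω : ℝ) : EReal) ≤
            min
              ((CalQL.transferCoeff M C πref ν πe : EReal) *
                ((c * (1 + Vmax + BX * BW) * CalQL.rate H K d F.size δ : ℝ) : EReal))
              ((K * (M.value H πe - M.refValue H πref)
                + c * (1 + Vmax + BX * BW) * CalQL.rate H K dref F.size δ : ℝ) : EReal)} := by
  -- `16 = 8 + 6 + 2`: the offline gap, the on-policy gap and round zero, the last two being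
  -- multiplied by a coefficient at least one.
  refine ⟨16, by norm_num, ?_⟩
  intro S A Ω _ _ _ Pr _ H K d dref δ Vmax BX BW M F C g πref ν _ run hH hK hd hdref hδ hδ1 hCF hC
    hQ hmax hbil hbilref
  -- One event must serve all comparators. Completeness does not mention the comparator, so any
  -- single pessimistic one supplies it; with none the claim is vacuous.
  by_cases hex : ∃ πe, CalQL.IsPessimistic M C πe
  swap
  · have : {ω | ∀ πe : CalQL.Policy S A, CalQL.IsPessimistic M C πe →
          ((run.regret πe ω : ℝ) : EReal) ≤
            min
              ((CalQL.transferCoeff M C πref ν πe : EReal) *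
                ((16 * (1 + Vmax + BX * BW) * CalQL.rate H K d F.size δ : ℝ) : EReal))
              ((K * (M.value H πe - M.refValue H πref)
                + 16 * (1 + Vmax + BX * BW) * CalQL.rate H K dref F.size δ : ℝ) : EReal)} =
        Set.univ :=
      Set.eq_univ_of_forall fun ω πe hπe => absurd ⟨πe, hπe⟩ hex
    rw [this, probReal_univ]
    linarith
  obtain ⟨π₀, hπ₀⟩ := hex
  obtain ⟨z₀⟩ : Nonempty (S × A) := (ν ⟨0, hH⟩).nonempty_of_neZero
  have hV : 0 ≤ Vmax := by
    have := (hC _ _ (hQ ⟨0, hH⟩)).2 z₀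
    exact this.1.trans this.2
  have hCC := hπ₀.isCompleteClass g hV hC hmax
  have hrefmem : (fun h : Fin H => M.Q H πref h) ∈ CalQL.calibrated M C πref :=
    fun h => ⟨hQ h, fun _ => le_rfl⟩
  have hBX : 0 ≤ BX := by
    obtain ⟨X, W, hX, hW, _⟩ := hbilref ⟨0, hH⟩
    exact (norm_nonneg _).trans (hX _ hrefmem)
  have hBW : 0 ≤ BW := by
    obtain ⟨X, W, hX, hW, _⟩ := hbilref ⟨0, hH⟩
    exact (norm_nonneg _).trans (hW _ hrefmem)
  have hBXW : 0 ≤ BX * BW := mul_nonneg hBX hBW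
  have hsize : 0 < C.size := CalQL.FunClass.size_pos hQ
  have hsizeF : C.size ≤ F.size := CalQL.FunClass.size_mono hCF
  obtain ⟨G, _, hGδ, hGood⟩ := run.exists_hasSmallErrors hCC hQ hV hH hK hsize hδ
  refine hGδ.trans (measureReal_mono fun ω hω πe hπe => ?_)
  have hb : 0 ≤ 16 * (1 + Vmax) ^ 2 * Real.log (H * K * C.size / δ) :=
    mul_nonneg (by positivity) (Real.log_nonneg (CalQL.one_le_mul_div hH hK hsize hδ hδ1))
  obtain ⟨n, rfl⟩ : ∃ n, K = n + 1 := ⟨K - 1, by omega⟩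
  have hsum : ∀ {G' : Set (CalQL.QTuple S A H)} {d' : ℕ}, CalQL.calibrated M C πref ⊆ G' →
      CalQL.IsBilinear M g G' d' BX BW →
      ∑ k ∈ Finset.range n, (∫ s, CalQL.supAct ((run.iter (k + 1) ω).at 0) s ∂M.ρ
        - M.value H (run.policy (k + 1) ω)) ≤
        6 * (1 + Vmax + BX * BW) * CalQL.rate H (n + 1) d' F.size δ := fun hsub hbil' =>
    (run.sum_sub_value_le hCC hb (hGood ω hω) n.le_succ hsub hBX hbil').trans
      (CalQL.sqrt_potential_le_rate hH hK n.le_succ hsize hsizeF hδ hδ1 hV hBXW)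
  have hVrate : ∀ {d' : ℕ}, 0 < d' →
      Vmax ≤ 2 * (1 + Vmax + BX * BW) * CalQL.rate H (n + 1) d' F.size δ := fun hd' => by
    have h := CalQL.half_le_rate hH hK hd' (hsize.trans_le hsizeF) hδ hδ1
    nlinarith
  refine le_min ?_ ?_
  · set β : ℝ := (1 + Vmax + BX * BW) * CalQL.rate H (n + 1) d F.size δ with hβ
    -- Strict positivity matters for an infinite coefficient, since `⊤ * 0 = 0` in `EReal`.
    have hβ0 : 0 < β := by
      have h := CalQL.half_le_rate hH hK hd (hsize.trans_le hsizeF) hδ hδ1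
      exact mul_pos (by positivity) (by linarith)
    rw [mul_assoc, ← hβ]
    by_cases htop : CalQL.transferCoeff M C πref ν πe = ⊤
    · rw [htop, EReal.coe_ennreal_top, EReal.top_mul_coe_of_pos (by positivity)]
      exact le_top
    · set c := (CalQL.transferCoeff M C πref ν πe).toReal with hcdef
      have hcoef : CalQL.transferCoeff M C πref ν πe = ENNReal.ofReal c :=
        (ENNReal.ofReal_toReal htop).symm
      have hc1 : 1 ≤ c := CalQL.one_le_of_transferCoeff_eq hcoef
      have hc0 : 0 ≤ c := by linarith
      rw [hcoef, EReal.coe_ennreal_ofReal, max_eq_left hc0, ← EReal.coe_mul, EReal.coe_le_coe_iff]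
      refine (run.regret_le_of_transferCoeff hCC (hGood ω hω) (hπe.value_le hH hC) hc0 hcoef
        (hsum (fun f hf h => (hf h).1) hbil)).trans ?_
      have h1 := CalQL.mul_sqrt_le_rate hH hK hd hsize hsizeF hδ hδ1 hV
      have h2 : 8 * (1 + Vmax) * CalQL.rate H (n + 1) d F.size δ ≤ 8 * β := by
        have := mul_nonneg hBXW (CalQL.rate_nonneg (H := H) (K := n + 1) (d := d) (N := F.size)
          (δ := δ))
        rw [hβ]
        linarith
      have h3 := mul_le_mul_of_nonneg_left (h1.trans h2) hc0
      have h4 := hVrate hd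
      rw [mul_assoc, ← hβ] at h4
      rw [mul_assoc 6, ← hβ]
      nlinarith
  · rw [EReal.coe_le_coe_iff]
    refine (run.regret_le_of_refValue hCC hQ hH (hsum subset_rfl hbilref)).trans ?_
    have h4 := hVrate hdref
    have h5 : 0 ≤ (1 + Vmax + BX * BW) * CalQL.rate H (n + 1) dref F.size δ :=
      mul_nonneg (by positivity) CalQL.rate_nonneg
    linarith
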